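/- Let $\mathrm{Imm}=\{c\in C^\infty(S^1,\mathbb R^3): c'\neq 0 \text{ everywhere}\}$, with tangent spaces $T_c\mathrm{Imm}=C^\infty(S^1,\mathbb R^3)$. Write $ds=|c'|\,d\theta$, $D_s=|c'|^{-1}\partial_\theta$, and $\ell_c=\int_{S^1}ds$ for the length. For a reparametrization-equivariant operator field $L$ on $C^\infty(S^1,\mathbb R^3)$, self-adjoint for $\int\langle\cdot,\cdot\rangle ds$, put $\Theta^L_c(h)=\int_{S^1}\langle c\times D_sc, L_ch\rangle\,ds$ and $\Omega^L=-d\Theta^L$, that is, for constant fields $h,k$, $\Omega^L_c(h,k)=-D_{c,h}\Theta^L(k)+D_{c,k}\Theta^L(h)$. Let $\Omega^{\mathrm{MW}}_c(h,k)=\int_{S^1}\langle D_sc\times h,k\rangle\,ds$ be the Marsden–Weinstein form, $V_c=\{a\,c': a\in C^\infty(S^1)\}$ the vertical space and $B_i=\mathrm{Imm}/\mathrm{Diff}^+(S^1)$, with tangent spaces $T_c\mathrm{Imm}/V_c$. A two-form is called symplectic if it is closed and weakly non-degenerate; a form that is only continuous is called closed if its integral over the boundary of every smooth singular cube vanishes.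 For a form $\Omega$ and a function $H$, a horizontal Hamiltonian vector of $H$ at $c$ is an $X$ with $dH_c=\Omega_c(X,\cdot)$ and $\int\langle X,v\rangle\,ds=0$ for all $v\in V_c$; it is denoted $\mathrm{hgrad}^{\Omega}H$ when it is unique. Let $\Phi\in C^1(\mathbb R_{>0},\mathbb R_{>0})$ and write $\Omega^{\Phi(\ell)}$ for the form of $L_c=\Phi(\ell_c)\,\mathrm{id}$. Then all the derivatives above exist, $D_{c,h}\ell=\int\langle D_sh,D_sc\rangle ds$, and for all $c\in\mathrm{Imm}$ and $h,k\in C^\infty(S^1,\mathbb R^3)$ $$\Omega^{\Phi(\ell)}_c(h,k)=\Phi(\ell_c)\Omega^{\mathrm{id}}_c(h,k)-\Phi'(\ell_c)\Big(\int\langle D_sh,D_sc\rangle ds\;\Theta^{\mathrm{id}}_c(k)-\int\langle D_sk,D_sc\rangle ds\;\Theta^{\mathrm{id}}_c(h)\Big)$$ $$=\Phi(\ell_c)\Omega^{\mathrm{id}}_c(h,k)+\Phi'(\ell_c)\Big(\int\langle h,D_s^2c\rangle ds\;\Theta^{\mathrm{id}}_c(k)-\int\langle k,D_s^2c\rangle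 ds\;\Theta^{\mathrm{id}}_c(h)\Big).$$ (a) $\Omega^{\Phi(\ell)}$ descends to a closed two-form $\bar\Omega^{\Phi(\ell)}$ on $B_i$. It is weakly non-degenerate at the class of $c$ if and only if $3\Phi(\ell_c)+\ell_c\Phi'(\ell_c)\neq0$, i.e. if and only if $(x^3\Phi(x))'\ne0$ at $x=\ell_c$. In particular, if $3\Phi(x)+x\Phi'(x)\neq 0$ for all $x>0$, then $\bar\Omega^{\Phi(\ell)}$ is symplectic. Moreover, if there are no constant $C$ and non-empty open interval in $\mathbb R_{>0}$ on which $\Phi(x)=Cx^{-3}$, then every smooth vector field $Y$ on $\mathrm{Imm}$ with $\Omega^{\Phi(\ell)}(Y,\cdot)=0$ is vertical. (b) Let $I_c=c$ be the scaling field and $X_c=D_sc\times D_s^2c$. Then $\mathrm{hgrad}^{\Omega^{\mathrm{MW}}}\ell=X$ and $\mathrm{hgrad}^{\Omega^{\mathrm{id}}}\ell=\tfrac13X$; the classes of $I_c$ and $X_c$ in $T_c\mathrm{Imm}/V_c$ are linearly independent for every $c$, and $[I,X]_c=D_{c,I_c}X-D_{c,X_c}I$ lies in $\mathcal F_c=\mathrm{span}\{I_c,X_c\}$.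 Suppose that $\Phi(x)=Cx^{-3}$ for all $x>0$. Let $\mathrm{Imm}/(\mathrm{Diff}^+(S^1)\times\mathcal F)$ be the quotient of $\mathrm{Imm}$ by the equivalence relation generated by reparametrizations and smooth paths tangent to $\mathcal F$, with tangent spaces $T_c\mathrm{Imm}/(V_c+\mathcal F_c)$. Let $\{\ell=1\}/(\mathrm{Diff}^+(S^1)\times\mathrm{span}\,X)$ be the corresponding quotient of the curves of length one by reparametrizations and smooth paths inside $\{\ell=1\}$ tangent to $X$, with tangent spaces $\ker d\ell_c/(V_c+\mathbb RX_c)$. Two-forms on such a quotient are families of alternating forms on these tangent spaces that are continuous and invariant under reparametrization and along the leaves. Then $\Omega^{\Phi(\ell)}$ descends to a symplectic form on $\mathrm{Imm}/(\mathrm{Diff}^+(S^1)\times\mathcal F)$, the restriction of $3C\,\Omega^{\mathrm{MW}}$ to $\{\ell=1\}$ descends to a symplectic form on $\{\ell=1\}/(\mathrm{Diff}^+(S^1)\times\mathrm{span}\,X)$, and the smooth map $c\mapsto c/\ell_c$ induces a bijection of the first quotient onto the second, with inverse induced by the inclusion, whose differential at each $c$ is a linear isomorphism of the tangent spaces of the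 quotients, and under which the two forms correspond. -/

import Mathlib

open scoped ContDiff

noncomputable section

namespace SpaceCurves

/-! Spaces of closed space curves.  The circle is `ℝ / 2πℤ`; maps on it are `2π`-periodic maps on
`ℝ`, and orientation preserving diffeomorphisms of it are represented by their lifts to `ℝ`. -/

/-- Euclidean three-space. -/
abbrev E3 : Type := EuclideanSpace ℝ (Fin 3)

/-- The vector cross product of `E3`. -/
def cross3 (u v : E3) : E3 := WithLp.toLp 2 (crossProduct u.ofLp v.ofLp)

/-- The vector space `C^∞(S¹, ℝ³)`. -/
@[ext]
structure Loop where
  val : ℝ → E3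
  smooth : ContDiff ℝ ∞ val
  periodic : Function.Periodic val (2 * Real.pi)

instance : Zero Loop := ⟨⟨0, contDiff_const, fun _ => rfl⟩⟩
instance : Add Loop := ⟨fun h k => ⟨h.val + k.val, h.2.add k.2, h.3.add k.3⟩⟩
instance : Neg Loop := ⟨fun h => ⟨-h.val, h.2.neg, fun θ => congrArg Neg.neg (h.3 θ)⟩⟩
instance : Sub Loop := ⟨fun h k => ⟨h.val - k.val, h.2.sub k.2, h.3.sub k.3⟩⟩
instance : SMul ℕ Loop := ⟨fun r h => ⟨r • h.val, h.2.const_smul r, h.3.smul r⟩⟩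
instance : SMul ℤ Loop := ⟨fun r h => ⟨r • h.val, h.2.const_smul r, h.3.smul r⟩⟩
instance : SMul ℝ Loop := ⟨fun r h => ⟨r • h.val, h.2.const_smul r, h.3.smul r⟩⟩

theorem Loop.val_injective : Function.Injective Loop.val := fun _ _ => Loop.ext

instance : AddCommGroup Loop :=
  Loop.val_injective.addCommGroup Loop.val rfl (fun _ _ => rfl) (fun _ => rfl) (fun _ _ => rfl)
    (fun _ _ => rfl) fun _ _ => rfl

instance : Module ℝ Loop :=
  Loop.val_injective.module ℝ ⟨⟨Loop.val, rfl⟩, fun _ _ => rfl⟩ fun _ _ => rfl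

/-- The space `Imm(S¹, ℝ³)` of smooth immersed closed curves. -/
abbrev Imm : Type := {c : Loop // ∀ θ, deriv c.1 θ ≠ 0}

theorem contDiff_deriv_loop (h : Loop) : ContDiff ℝ ∞ (deriv h.1) :=
  (contDiff_infty_iff_deriv.1 h.2).2

theorem periodic_deriv_loop (h : Loop) : Function.Periodic (deriv h.1) (2 * Real.pi) := by
  intro θ
  have h1 : (fun x => h.1 (x + 2 * Real.pi)) = h.1 := funext h.3
  rw [← deriv_comp_add_const, h1]

/-- The arclength derivative `D_s h = |c'|⁻¹ h'` of a field `h` along the immersion `c`. -/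
def Ds (c : Imm) (h : Loop) : Loop :=
  ⟨fun θ => ‖deriv c.1.1 θ‖⁻¹ • deriv h.1 θ,
    (((contDiff_deriv_loop c.1).norm ℝ c.2).inv fun θ => norm_ne_zero_iff.2 (c.2 θ)).smul
      (contDiff_deriv_loop h),
    fun θ => by simp only [periodic_deriv_loop c.1 θ, periodic_deriv_loop h θ]⟩

/-- The pointwise cross product of two fields. -/
def crossLoop (h k : Loop) : Loop :=
  ⟨fun θ => cross3 (h.1 θ) (k.1 θ), by
    have hh : ∀ i, ContDiff ℝ ∞ fun θ => (h.1 θ).ofLp i := contDiff_euclidean.1 h.2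
    have hk : ∀ i, ContDiff ℝ ∞ fun θ => (k.1 θ).ofLp i := contDiff_euclidean.1 k.2
    refine contDiff_euclidean.2 fun i => ?_
    fin_cases i <;> simp only [cross3, cross_apply] <;>
      exact ((hh _).mul (hk _)).sub ((hh _).mul (hk _)),
    fun θ => by simp only [h.3 θ, k.3 θ]⟩

/-- Integration over the circle with respect to arclength, `∫ f ds = ∫ f |c'| dθ`. -/
def arcInt (c : Imm) (f : ℝ → ℝ) : ℝ := ∫ θ in (0 : ℝ)..(2 * Real.pi), f θ * ‖deriv c.1.1 θ‖

/-- The length of a curve. -/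
def length (c : Imm) : ℝ := arcInt c fun _ => 1

/-- The invariant `L²` pairing `∫ ⟨h, k⟩ ds`. -/
def pairing (c : Imm) (h k : Loop) : ℝ := arcInt c fun θ => inner ℝ (h.1 θ) (k.1 θ)

/-- The metric `G^L_c(h, k) = ∫ ⟨h, L_c k⟩ ds` of a self-adjoint operator field `L`. -/
def metric (L : Imm → Loop → Loop) (c : Imm) (h k : Loop) : ℝ := pairing c h (L c k)

/-- The Liouville one-form `Θ^L_c(h) = G^L_c(c × D_s c, h)`. -/
def liouville (L : Imm → Loop → Loop) (c : Imm) (h : Loop) : ℝ :=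
  metric L c (crossLoop c.1 (Ds c c.1)) h

/-- The operator field `L_c = id`. -/
def idOp : Imm → Loop → Loop := fun _ h => h

/-- The length-weighted operator field `L_c = Φ(ℓ_c) id`. -/
def lengthOp (Φ : ℝ → ℝ) : Imm → Loop → Loop := fun c h => Φ (length c) • h

/-! ### Calculus on spaces of curves

Smooth maps from a finite dimensional space into `C^∞(S¹, ℝ³)` are the jointly smooth maps. -/

/-- Smooth families of loops. -/
def SmoothFamily {P : Type} [NormedAddCommGroup P] [NormedSpace ℝ P] (γ : P → Loop) : Prop :=
  ContDiff ℝ ∞ fun p : P × ℝ => (γ p.1).1 p.2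

/-- `v` is the velocity at time `t` of the path `γ`. -/
def HasVelocity (γ : ℝ → Loop) (t : ℝ) (v : Loop) : Prop :=
  ∀ θ, HasDerivAt (fun s => (γ s).1 θ) (v.1 θ) t

/-- `a` is the derivative at `c` in direction `h` of the function `F` on immersions: the derivative
of `F` along every smooth path through `c` with velocity `h`. -/
def HasDirDeriv (F : Imm → ℝ) (c : Imm) (h : Loop) (a : ℝ) : Prop :=
  ∀ γ : ℝ → Imm, SmoothFamily (fun t => (γ t).1) → γ 0 = c →
    HasVelocity (fun t => (γ t).1) 0 h → HasDerivAt (fun t => F (γ t)) a 0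

theorem deriv_loop_add (h k : Loop) (θ : ℝ) :
    deriv (h + k).1 θ = deriv h.1 θ + deriv k.1 θ :=
  deriv_add (h.2.differentiable (by simp) θ) (k.2.differentiable (by simp) θ)

theorem deriv_loop_smul (r : ℝ) (h : Loop) (θ : ℝ) :
    deriv (r • h).1 θ = r • deriv h.1 θ :=
  deriv_const_smul r (h.2.differentiable (by simp) θ)

/-- Every tangent vector is the velocity of a smooth path of immersions. -/
theorem exists_path (c : Imm) (h : Loop) : ∃ γ : ℝ → Imm,
    SmoothFamily (fun t => (γ t).1) ∧ γ 0 = c ∧ HasVelocity (fun t => (γ t).1) 0 h := by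
  have cc : Continuous fun θ => ‖deriv c.1.1 θ‖ := (contDiff_deriv_loop c.1).continuous.norm
  have ch : Continuous fun θ => ‖deriv h.1 θ‖ := (contDiff_deriv_loop h).continuous.norm
  have hne : (Set.Icc 0 (2 * Real.pi)).Nonempty := ⟨0, le_refl _, Real.two_pi_pos.le⟩
  obtain ⟨x, -, hx⟩ := isCompact_Icc.exists_isMinOn hne cc.continuousOn
  obtain ⟨y, -, hy⟩ := isCompact_Icc.exists_isMaxOn hne ch.continuousOn
  have hm : 0 < ‖deriv c.1.1 x‖ := norm_pos_iff.2 (c.2 x)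
  obtain ⟨δ, hδ, hδM⟩ : ∃ δ : ℝ, 0 < δ ∧ δ * ‖deriv h.1 y‖ < ‖deriv c.1.1 x‖ := by
    refine ⟨‖deriv c.1.1 x‖ / (‖deriv h.1 y‖ + 1), by positivity, ?_⟩
    rw [div_mul_eq_mul_div, div_lt_iff₀ (by positivity)]
    nlinarith [norm_nonneg (deriv h.1 y)]
  have hd : ∀ r θ, deriv (c.1 + r • h).1 θ = deriv c.1.1 θ + r • deriv h.1 θ := fun r θ => by
    rw [deriv_loop_add, deriv_loop_smul]
  have himm : ∀ t θ, deriv (c.1 + (δ * Real.sin (t / δ)) • h).1 θ ≠ 0 := by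
    intro t θ h0
    have hp : Function.Periodic (fun θ => (deriv c.1.1 θ, deriv h.1 θ)) (2 * Real.pi) :=
      fun θ => by simp only [periodic_deriv_loop c.1 θ, periodic_deriv_loop h θ]
    obtain ⟨z, hz, hcz⟩ := hp.exists_mem_Ico₀ Real.two_pi_pos θ
    have hz' : z ∈ Set.Icc 0 (2 * Real.pi) := ⟨hz.1, hz.2.le⟩
    have hz1 : deriv c.1.1 θ = deriv c.1.1 z := (Prod.ext_iff.1 hcz).1
    have hz2 : deriv h.1 θ = deriv h.1 z := (Prod.ext_iff.1 hcz).2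
    rw [hd, hz1, hz2] at h0
    have h1 : ‖deriv c.1.1 z‖ = |δ * Real.sin (t / δ)| * ‖deriv h.1 z‖ := by
      rw [eq_neg_of_add_eq_zero_left h0, norm_neg, norm_smul, Real.norm_eq_abs]
    have h2 : |δ * Real.sin (t / δ)| ≤ δ := by
      rw [abs_mul, abs_of_pos hδ]
      exact mul_le_of_le_one_right hδ.le (Real.abs_sin_le_one _)
    have h3 : ‖deriv c.1.1 x‖ ≤ ‖deriv c.1.1 z‖ := hx hz'
    have h4 : ‖deriv h.1 z‖ ≤ ‖deriv h.1 y‖ := hy hz'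
    have h5 := mul_le_mul h2 h4 (norm_nonneg _) hδ.le
    linarith
  refine ⟨fun t => ⟨c.1 + (δ * Real.sin (t / δ)) • h, himm t⟩, ?_, ?_, ?_⟩
  · have h1 : ContDiff ℝ ∞ fun p : ℝ × ℝ => δ * Real.sin (p.1 / δ) :=
      contDiff_const.mul (Real.contDiff_sin.comp (contDiff_fst.div_const δ))
    exact (c.1.2.comp contDiff_snd).add (h1.smul (h.2.comp contDiff_snd))
  · apply Subtype.ext
    simp
  · intro θ
    have h1 : HasDerivAt (fun s : ℝ => δ * Real.sin (s / δ)) 1 0 := by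
      have := ((((hasDerivAt_id (0 : ℝ)).div_const δ).sin).const_mul δ)
      simpa [hδ.ne'] using this
    have h2 := (h1.smul_const (h.1 θ)).const_add (c.1.1 θ)
    rw [one_smul] at h2
    exact h2

/-- Directional derivatives are unique. -/
theorem HasDirDeriv.unique {F : Imm → ℝ} {c : Imm} {h : Loop} {a b : ℝ}
    (ha : HasDirDeriv F c h a) (hb : HasDirDeriv F c h b) : a = b := by
  obtain ⟨γ, h1, h2, h3⟩ := exists_path c h
  exact (ha γ h1 h2 h3).unique (hb γ h1 h2 h3)

/-- The directional derivative `D_{c,h} F` (meaningful when it exists). -/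
def dirDeriv (F : Imm → ℝ) (c : Imm) (h : Loop) : ℝ :=
  Classical.epsilon (HasDirDeriv F c h)

/-- The directional derivative of a vector field. -/
def HasFieldDeriv (Y : Imm → Loop) (c : Imm) (h Z : Loop) : Prop :=
  ∀ γ : ℝ → Imm, SmoothFamily (fun t => (γ t).1) → γ 0 = c →
    HasVelocity (fun t => (γ t).1) 0 h → HasVelocity (fun t => Y (γ t)) 0 Z

/-- Smooth vector fields on the space of immersions. -/
def SmoothField (Y : Imm → Loop) : Prop :=
  ∀ (n : ℕ) (γ : (Fin n → ℝ) → Imm), SmoothFamily (fun p => (γ p).1) →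
    SmoothFamily fun p => Y (γ p)

/-- The form `Ω^L = -dΘ^L`, evaluated on constant vector fields:
`Ω^L_c(h, k) = -D_{c,h} Θ^L(k) + D_{c,k} Θ^L(h)`. -/
def Omega (L : Imm → Loop → Loop) (c : Imm) (h k : Loop) : ℝ :=
  -dirDeriv (fun b => liouville L b k) c h + dirDeriv (fun b => liouville L b h) c k

/-- The Marsden-Weinstein form `∫ ⟨D_s c × h, k⟩ ds`. -/
def OmegaMW (c : Imm) (h k : Loop) : ℝ := pairing c (crossLoop (Ds c c.1) h) k

/-- The vertical space at `c`: fields `a c'` with a smooth function `a` on the circle. -/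
def vertical (c : Imm) : Submodule ℝ Loop where
  carrier := {h | ∃ a : ℝ → ℝ, ContDiff ℝ ∞ a ∧ Function.Periodic a (2 * Real.pi) ∧
    ∀ θ, h.1 θ = a θ • deriv c.1.1 θ}
  add_mem' := by
    rintro h k ⟨a, ha, ha', hh⟩ ⟨b, hb, hb', hk⟩
    refine ⟨fun θ => a θ + b θ, ha.add hb, ha'.add hb', fun θ => ?_⟩
    rw [add_smul, ← hh, ← hk]; rfl
  zero_mem' := ⟨fun _ => 0, contDiff_const, fun _ => rfl, fun θ => (zero_smul ℝ _).symm⟩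
  smul_mem' := by
    rintro r h ⟨a, ha, ha', hh⟩
    refine ⟨fun θ => r * a θ, contDiff_const.mul ha, fun θ => by simp only [ha' θ], fun θ => ?_⟩
    rw [mul_smul, ← hh]; rfl

/-- `X` is the horizontal Hamiltonian vector of `H` at `c` for the form `Ω`. -/
def IsHGrad (Ω : Imm → Loop → Loop → ℝ) (H : Imm → ℝ) (c : Imm) (X : Loop) : Prop :=
  (∀ k, HasDirDeriv H c k (Ω c X k)) ∧ ∀ v ∈ vertical c, pairing c X v = 0

/-- The field `D_s c × D_s² c`. -/
def binormal (c : Imm) : Loop := crossLoop (Ds c c.1) (Ds c (Ds c c.1))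

/-! ### Length and its variation -/

theorem continuous_loop (h : Loop) : Continuous h.1 := h.2.continuous

theorem continuous_deriv_loop (h : Loop) : Continuous (deriv h.1) :=
  (contDiff_deriv_loop h).continuous

theorem length_pos (c : Imm) : 0 < length c := by
  unfold length arcInt
  refine intervalIntegral.intervalIntegral_pos_of_pos ?_ (fun θ => ?_) Real.two_pi_pos
  · exact (continuous_const.mul (continuous_deriv_loop c.1).norm).intervalIntegrable _ _
  · have := norm_pos_iff.2 (c.2 θ)
    simpa using this

theorem Ds_add (c : Imm) (h k : Loop) : Ds c (h + k) = Ds c h + Ds c k := by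
  apply Loop.ext
  funext θ
  simp only [Ds, deriv_loop_add, smul_add]; rfl

theorem Ds_smul (c : Imm) (r : ℝ) (h : Loop) : Ds c (r • h) = r • Ds c h := by
  apply Loop.ext
  funext θ
  simp only [Ds, deriv_loop_smul, smul_comm _ r]; rfl

theorem pairing_add_left (c : Imm) (h h' k : Loop) :
    pairing c (h + h') k = pairing c h k + pairing c h' k := by
  unfold pairing arcInt
  rw [← intervalIntegral.integral_add]
  · congr 1
    funext θ
    rw [← add_mul, ← inner_add_left]; rfl
  all_goals
    exact (((continuous_loop _).inner (continuous_loop _)).mul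
      (continuous_deriv_loop c.1).norm).intervalIntegrable _ _

theorem pairing_smul_left (c : Imm) (r : ℝ) (h k : Loop) :
    pairing c (r • h) k = r * pairing c h k := by
  unfold pairing arcInt
  rw [← intervalIntegral.integral_const_mul]
  congr 1
  funext θ
  rw [← mul_assoc, ← real_inner_smul_left]; rfl

/-- The variation of length, `dℓ_c(h) = ∫ ⟨D_s h, D_s c⟩ ds`. -/
def dLength (c : Imm) : Loop →ₗ[ℝ] ℝ where
  toFun h := pairing c (Ds c h) (Ds c c.1)
  map_add' h k := by rw [Ds_add, pairing_add_left]
  map_smul' r h := by rw [Ds_smul, pairing_smul_left]; rfl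

/-- The rescaled curve `c / ℓ_c`. -/
def normalize (c : Imm) : Imm :=
  ⟨(length c)⁻¹ • c.1, fun θ => by
    rw [deriv_loop_smul]
    exact smul_ne_zero (inv_ne_zero (length_pos c).ne') (c.2 θ)⟩

theorem length_normalize (c : Imm) : length (normalize c) = 1 := by
  have h0 := length_pos c
  have h1 : length (normalize c) = (length c)⁻¹ * length c := by
    have h2 : (length c)⁻¹ * length c =
        ∫ θ in (0 : ℝ)..(2 * Real.pi), (length c)⁻¹ * (1 * ‖deriv c.1.1 θ‖) := by
      rw [intervalIntegral.integral_const_mul]; rfl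
    rw [h2, length, arcInt]
    congr 1
    funext θ
    have : deriv (normalize c).1.1 θ = (length c)⁻¹ • deriv c.1.1 θ :=
      deriv_loop_smul (length c)⁻¹ c.1 θ
    rw [this, norm_smul, norm_inv, Real.norm_of_nonneg h0.le]; ring
  rw [h1, inv_mul_cancel₀ h0.ne']

theorem dLength_normalize (c : Imm) (h : Loop) : dLength (normalize c) h = dLength c h := by
  have h0 := length_pos c
  change pairing _ _ _ = pairing _ _ _
  unfold pairing arcInt
  congr 1
  funext θ
  have h2 : deriv (normalize c).1.1 θ = (length c)⁻¹ • deriv c.1.1 θ :=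
    deriv_loop_smul (length c)⁻¹ c.1 θ
  have h3 : ‖deriv c.1.1 θ‖ ≠ 0 := norm_ne_zero_iff.2 (c.2 θ)
  simp only [Ds, h2, norm_smul, norm_inv, Real.norm_of_nonneg h0.le, real_inner_smul_left,
    real_inner_smul_right]
  field_simp

theorem dLength_self (c : Imm) : dLength c c.1 = length c := by
  change pairing _ _ _ = _
  unfold pairing length arcInt
  congr 1
  funext θ
  have h3 : ‖deriv c.1.1 θ‖ ≠ 0 := norm_ne_zero_iff.2 (c.2 θ)
  simp only [Ds, real_inner_self_eq_norm_sq, norm_smul, norm_inv, norm_norm]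
  rw [inv_mul_cancel₀ h3]; norm_num

/-- The differential of `c ↦ c / ℓ_c`, with values in the kernel of the variation of length. -/
def dNormalize (c : Imm) (h : Loop) : LinearMap.ker (dLength (normalize c)) :=
  ⟨(length c)⁻¹ • h - (dLength c h / length c ^ 2) • c.1, by
    have h0 := (length_pos c).ne'
    rw [LinearMap.mem_ker, map_sub, map_smul, map_smul, dLength_normalize, dLength_normalize,
      dLength_self, smul_eq_mul, smul_eq_mul]
    field_simp
    ring⟩

/-! ### Reparametrizations -/

/-- Lifts to `ℝ` of the orientation preserving diffeomorphisms of the circle. -/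
structure DiffPlus where
  toFun : ℝ → ℝ
  smooth : ContDiff ℝ ∞ toFun
  map_add : ∀ θ, toFun (θ + 2 * Real.pi) = toFun θ + 2 * Real.pi
  deriv_pos : ∀ θ, 0 < deriv toFun θ

/-- The action `h ↦ h ∘ φ` on fields. -/
def reparam (h : Loop) (φ : DiffPlus) : Loop :=
  ⟨fun θ => h.1 (φ.toFun θ), h.2.comp φ.smooth, fun θ => by
    simp only [φ.map_add]; exact h.3 _⟩

/-- The action `c ↦ c ∘ φ` on immersions. -/
def Imm.reparam (c : Imm) (φ : DiffPlus) : Imm :=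
  ⟨SpaceCurves.reparam c.1 φ, fun θ => by
    have h1 := (c.1.2.differentiable (by simp) (φ.toFun θ)).hasDerivAt.scomp θ
      (φ.smooth.differentiable (by simp) θ).hasDerivAt
    have h2 : deriv (SpaceCurves.reparam c.1 φ).1 θ
        = deriv φ.toFun θ • deriv c.1.1 (φ.toFun θ) := h1.deriv
    rw [h2]
    exact smul_ne_zero (φ.deriv_pos θ).ne' (c.2 _)⟩

/-! ### Quotients by reparametrizations and by a foliation -/

/-- A quotient `M / (Diff⁺(S¹) × F)`: a space `M` of immersions, its tangent spaces, and a
distribution `F` on it. -/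
structure QuotData where
  carrier : Set Imm
  tangent : Imm → Submodule ℝ Loop
  fol : Imm → Submodule ℝ Loop

namespace QuotData

variable (D : QuotData)

/-- Two curves are identified if they differ by a reparametrization or are joined inside `M` by a
smooth path tangent to `F`. -/
def Rel (c₀ c₁ : D.carrier) : Prop :=
  (∃ φ : DiffPlus, c₁.1 = c₀.1.reparam φ) ∨
  ∃ γ : ℝ → D.carrier, SmoothFamily (fun t => (γ t).1.1) ∧
    (∀ t, ∃ v ∈ D.fol (γ t).1, HasVelocity (fun s => (γ s).1.1) t v) ∧ γ 0 = c₀ ∧ γ 1 = c₁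

/-- The quotient space: the quotient of `M` by the equivalence relation that `Rel` generates. -/
def Space : Type := Quot D.Rel

/-- The class of a curve. -/
def toSpace (c : D.carrier) : D.Space := Quot.mk _ c

/-- The tangent space of the quotient, `T_c M / (V_c + F_c)`, with `V_c` the vertical space. -/
abbrev Tang (c : D.carrier) : Type :=
  D.tangent c.1 ⧸ (vertical c.1 ⊔ D.fol c.1).comap (D.tangent c.1).subtype

/-- The projection from the tangent space of `M` to the tangent space of the quotient. -/
def proj (c : D.carrier) : D.tangent c.1 →ₗ[ℝ] D.Tang c := Submodule.mkQ _

/-- Continuous two-forms on the quotient: alternating forms on the tangent spaces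
`T_c M / (V_c + F_c)` that do not depend on the representative `c`, neither within an orbit
of the reparametrization group nor within a leaf of `F`.  The latter means that a two-parameter
family of curves has the same pullback when it is moved along the leaves. -/
structure TwoForm where
  form : ∀ c : D.carrier, D.Tang c →ₗ[ℝ] D.Tang c →ₗ[ℝ] ℝ
  alt : ∀ c u, form c u u = 0
  reparam_inv : ∀ (c c' : D.carrier) (φ : DiffPlus), c'.1 = c.1.reparam φ →
    ∀ (h k : D.tangent c.1) (h' k' : D.tangent c'.1),
      h'.1 = reparam h.1 φ → k'.1 = reparam k.1 φ →
      form c' (D.proj c' h') (D.proj c' k') = form c (D.proj c h) (D.proj c k)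
  leaf_inv : ∀ (γ : ℝ × ℝ × ℝ → D.carrier) (ξ η : ∀ p, D.tangent (γ p).1),
    SmoothFamily (fun p => (γ p).1.1) →
    (∀ t x y, ∃ v ∈ D.fol (γ (t, x, y)).1, HasVelocity (fun s => (γ (s, x, y)).1.1) t v) →
    (∀ t x y, HasVelocity (fun s => (γ (t, s, y)).1.1) x (ξ (t, x, y)).1) →
    (∀ t x y, HasVelocity (fun s => (γ (t, x, s)).1.1) y (η (t, x, y)).1) →
    ∀ t t' x y,
      form (γ (t, x, y)) (D.proj _ (ξ (t, x, y))) (D.proj _ (η (t, x, y)))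
        = form (γ (t', x, y)) (D.proj _ (ξ (t', x, y))) (D.proj _ (η (t', x, y)))
  cont : ∀ (n : ℕ) (γ : (Fin n → ℝ) → D.carrier) (ξ η : ∀ p, D.tangent (γ p).1),
    SmoothFamily (fun p => (γ p).1.1) → SmoothFamily (fun p => (ξ p).1) →
    SmoothFamily (fun p => (η p).1) →
    Continuous fun p => form (γ p) (D.proj _ (ξ p)) (D.proj _ (η p))

namespace TwoForm

variable {D}

/-- The form is (weakly) non-degenerate at `c`. -/
def NondegAt (ρ : D.TwoForm) (c : D.carrier) : Prop :=
  ∀ u : D.Tang c, (∀ v : D.Tang c, ρ.form c u v = 0) → u = 0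

/-- The form is closed: its integral over the boundary of every smooth singular cube vanishes.
For continuously differentiable forms this says that the exterior derivative is zero, and
it makes sense for forms that are only continuous. -/
def Closed (ρ : D.TwoForm) : Prop :=
  ∀ (γ : ℝ × ℝ × ℝ → D.carrier) (ξ η ζ : ∀ p, D.tangent (γ p).1),
    SmoothFamily (fun p => (γ p).1.1) →
    (∀ x y z, HasVelocity (fun s => (γ (s, y, z)).1.1) x (ξ (x, y, z)).1) →
    (∀ x y z, HasVelocity (fun s => (γ (x, s, z)).1.1) y (η (x, y, z)).1) →
    (∀ x y z, HasVelocity (fun s => (γ (x, y, s)).1.1) z (ζ (x, y, z)).1) →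
    let w (α β : ∀ p, D.tangent (γ p).1) (x y z : ℝ) : ℝ :=
      ρ.form (γ (x, y, z)) (D.proj _ (α (x, y, z))) (D.proj _ (β (x, y, z)))
    (∫ x in (0 : ℝ)..1, ∫ y in (0 : ℝ)..1, (w ξ η x y 1 - w ξ η x y 0))
      + (∫ y in (0 : ℝ)..1, ∫ z in (0 : ℝ)..1, (w η ζ 1 y z - w η ζ 0 y z))
      + (∫ z in (0 : ℝ)..1, ∫ x in (0 : ℝ)..1, (w ζ ξ x 1 z - w ζ ξ x 0 z)) = 0

/-- (Weakly) symplectic forms: closed and non-degenerate. -/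
def IsSymplectic (ρ : D.TwoForm) : Prop := ρ.Closed ∧ ∀ c, ρ.NondegAt c

end TwoForm

end QuotData

/-- The shape space `B_i(S¹, ℝ³) = Imm(S¹, ℝ³) / Diff⁺(S¹)`. -/
def shapeSpace : QuotData := ⟨Set.univ, fun _ => ⊤, fun _ => ⊥⟩

/-- The span of the scaling field `I_c = c` and the field `D_s c × D_s² c`. -/
def scaleBinormal (c : Imm) : Submodule ℝ Loop := Submodule.span ℝ {c.1, binormal c}

/-- The quotient `Imm(S¹, ℝ³) / (Diff⁺(S¹) × F)`, where `F` is spanned by `I` and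
`D_s c × D_s² c`. -/
def leafSpace : QuotData := ⟨Set.univ, fun _ => ⊤, scaleBinormal⟩

/-- The quotient of the curves of length one in the shape space by the span of
`D_s c × D_s² c`. -/
def unitLeafSpace : QuotData :=
  ⟨{c | length c = 1}, fun c => LinearMap.ker (dLength c), fun c => Submodule.span ℝ {binormal c}⟩

/-- A curve as a point of the total space of `shapeSpace`. -/
def inShape (c : Imm) : shapeSpace.carrier := ⟨c, trivial⟩

/-- A curve as a point of the total space of `leafSpace`. -/
def inLeaf (c : Imm) : leafSpace.carrier := ⟨c, trivial⟩

/-- The curve `c / ℓ_c` as a point of the total space of `unitLeafSpace`. -/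
def inUnit (c : Imm) : unitLeafSpace.carrier := ⟨normalize c, length_normalize c⟩

/-- The tangent vector of the shape space represented by `h`. -/
def tangShape (c : Imm) (h : Loop) : shapeSpace.Tang (inShape c) :=
  shapeSpace.proj (inShape c) ⟨h, trivial⟩

/-- The tangent vector of `leafSpace` represented by `h`. -/
def tangLeaf (c : Imm) (h : Loop) : leafSpace.Tang (inLeaf c) :=
  leafSpace.proj (inLeaf c) ⟨h, trivial⟩

end SpaceCurves

end

noncomputable section

namespace SpaceCurves

/-! ### Parameter integrals -/

/-! In `Θ^id_c(k) = ∫ det(c, c', k) dθ` the speeds cancel, so its exterior derivative is pure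
multilinear algebra plus one integration by parts: `Ω^id = 3 Ω^MW` (`dLiouville_antisymm`). The
product rule then gives `Ω^Φ = 3Φ Ω^MW - Φ' dℓ ∧ Θ`, which is `lengthForm`.

Everything about the kernel follows from two fields, the scaling field `I` and the binormal `X`.
They are dual to the two one-forms, `ι_X Ω^MW = dℓ` and `ι_I Ω^MW = -Θ`, while `dℓ(I) = Θ(X) = ℓ`
and `dℓ(X) = Θ(I) = 0`. Hence `ι_X Ω^Φ = (3Φ + ℓΦ') dℓ` and `ι_I Ω^Φ = -(3Φ + ℓΦ') Θ`. If the factor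
is non-zero, a kernel vector has `dℓ = Θ = 0`, so it lies in the kernel of `Ω^MW`, which is the
vertical space. If the factor is zero, `I` and `X` are in the kernel, and subtracting a combination
of them reduces to the same case. For a smooth field in the kernel, moving along the dilations `e^s
c` shows that it can be non-vertical only if the factor vanishes on an interval of lengths, that is,
if `x³Φ` is constant there.

Since `Φ` is only `C¹`, the form is only continuous. Closedness is therefore Stokes' theorem for the
`C¹` integrands of `Θ^Φ`: every face of a cube reduces to its edges, and the edges cancel
(`integral_lengthForm_cube`). Invariance along the leaves follows by sweeping a small square in a
kernel direction and shrinking it (`lengthForm_leaf_inv`).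

For `Φ = C x⁻³` the factor vanishes identically and `Ω^Φ` is the pullback of `3C Ω^MW` on `{ℓ = 1}`
under `c ↦ c / ℓ_c` (`lengthForm_normalize`). This map collapses the scaling direction and preserves
the binormal direction, and `c` is joined to `c / ℓ_c` by a dilation path, so the quotients agree.
-/

theorem hasFDerivAt_integral_of_contDiff {P E : Type} [NormedAddCommGroup P] [NormedSpace ℝ P]
    [NormedAddCommGroup E] [NormedSpace ℝ E] {F : P × ℝ → E} (hF : ContDiff ℝ 1 F)
    (a b : ℝ) (p : P) :
    HasFDerivAt (fun p => ∫ θ in a..b, F (p, θ))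
      (∫ θ in a..b, (fderiv ℝ F (p, θ)).comp (ContinuousLinearMap.inl ℝ P ℝ)) p := by
  have hc : Continuous fun q : P × ℝ => (fderiv ℝ F q).comp (ContinuousLinearMap.inl ℝ P ℝ) :=
    (hF.continuous_fderiv one_ne_zero).clm_comp continuous_const
  have hd : ∀ (x : P) (θ : ℝ), HasFDerivAt (fun x => F (x, θ))
      ((fderiv ℝ F (x, θ)).comp (ContinuousLinearMap.inl ℝ P ℝ)) x := fun x θ =>
    ((hF.differentiable one_ne_zero (x, θ)).hasFDerivAt).comp x (hasFDerivAt_prodMk_left x θ)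
  obtain ⟨M, hM⟩ := (isCompact_uIcc (a := a) (b := b)).exists_bound_of_continuousOn
    (f := fun θ => (fderiv ℝ F (p, θ)).comp (ContinuousLinearMap.inl ℝ P ℝ))
    (hc.comp (by fun_prop : Continuous fun θ : ℝ => (p, θ))).continuousOn
  have hU : IsOpen {q : P × ℝ |
      ‖(fderiv ℝ F q).comp (ContinuousLinearMap.inl ℝ P ℝ)‖ < M + 1} :=
    isOpen_lt hc.norm continuous_const
  -- `P` need not be locally compact. The tube lemma extends the bound `M` on `{p} × [a, b]` to the
  -- bound `M + 1` over a whole neighbourhood of `p`, which serves as the dominating constant.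
  obtain ⟨u, v, hu, -, hpu, hv, huv⟩ := generalized_tube_lemma (isCompact_singleton (x := p))
    (isCompact_uIcc (a := a) (b := b)) hU (by
      rintro ⟨x, θ⟩ ⟨hx, hθ⟩
      obtain rfl : x = p := hx
      exact (hM θ hθ).trans_lt (lt_add_one M))
  refine intervalIntegral.hasFDerivAt_integral_of_dominated_of_fderiv_le (𝕜 := ℝ) (s := u)
    (F' := fun x θ => (fderiv ℝ F (x, θ)).comp (ContinuousLinearMap.inl ℝ P ℝ))
    (bound := fun _ => M + 1) (hu.mem_nhds (hpu rfl)) ?_ ?_ ?_ ?_ ?_ ?_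
  · exact Filter.Eventually.of_forall fun x =>
      (hF.continuous.comp (by fun_prop : Continuous fun θ : ℝ => (x, θ))).aestronglyMeasurable
  · exact (hF.continuous.comp
      (by fun_prop : Continuous fun θ : ℝ => (p, θ))).intervalIntegrable _ _
  · exact (hc.comp (by fun_prop : Continuous fun θ : ℝ => (p, θ))).aestronglyMeasurable
  · exact Filter.Eventually.of_forall fun θ hθ x hx =>
      (show _ < M + 1 from huv ⟨hx, hv (Set.uIoc_subset_uIcc hθ)⟩).le
  · exact intervalIntegrable_const
  · exact Filter.Eventually.of_forall fun θ _ x _ => hd x θ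

theorem continuous_integral_param {P E : Type} [NormedAddCommGroup P]
    [NormedAddCommGroup E] [NormedSpace ℝ E] {F : P × ℝ → E} (hF : Continuous F) (a b : ℝ) :
    Continuous fun p => ∫ θ in a..b, F (p, θ) :=
  intervalIntegral.continuous_parametric_intervalIntegral_of_continuous'
    (f := fun p θ => F (p, θ)) hF a b

/-- The target `E` is generalised in the induction because the derivative of the integral is an
integral with values in `P →L[ℝ] E`. -/
theorem contDiff_integral_nat {P : Type} [NormedAddCommGroup P] [NormedSpace ℝ P] (a b : ℝ)
    (n : ℕ) : ∀ {E : Type} [NormedAddCommGroup E] [NormedSpace ℝ E] {F : P × ℝ → E},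
      ContDiff ℝ n F → ContDiff ℝ n fun p => ∫ θ in a..b, F (p, θ) := by
  induction n with
  | zero =>
    intro E _ _ F hF
    exact contDiff_zero.2 (continuous_integral_param hF.continuous a b)
  | succ n ih =>
    intro E _ _ F hF
    have h1 : ContDiff ℝ 1 F := hF.of_le (by exact_mod_cast Nat.le_add_left 1 n)
    have hd := hasFDerivAt_integral_of_contDiff h1 a b
    have h2 : ContDiff ℝ n (fderiv ℝ F) := hF.fderiv_right (by exact_mod_cast le_rfl)
    rw [show ((n + 1 : ℕ) : WithTop ℕ∞) = n + 1 by norm_cast, contDiff_succ_iff_fderiv]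
    refine ⟨fun p => (hd p).differentiableAt, by simp, ?_⟩
    rw [show fderiv ℝ (fun p => ∫ θ in a..b, F (p, θ)) = _ from funext fun p => (hd p).fderiv]
    exact ih (F := fun q => (fderiv ℝ F q).comp (ContinuousLinearMap.inl ℝ P ℝ))
      (h2.clm_comp contDiff_const)

theorem contDiff_integral {P E : Type} [NormedAddCommGroup P] [NormedSpace ℝ P]
    [NormedAddCommGroup E] [NormedSpace ℝ E] {F : P × ℝ → E} (hF : ContDiff ℝ ∞ F) (a b : ℝ) :
    ContDiff ℝ ∞ fun p => ∫ θ in a..b, F (p, θ) :=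
  contDiff_infty.2 fun n => contDiff_integral_nat a b n (contDiff_infty.1 hF n)

theorem hasDerivAt_integral {F : ℝ × ℝ → ℝ} (hF : ContDiff ℝ 1 F) {t : ℝ} {F' : ℝ → ℝ}
    (h : ∀ θ, HasDerivAt (fun s => F (s, θ)) (F' θ) t) (a b : ℝ) :
    HasDerivAt (fun s => ∫ θ in a..b, F (s, θ)) (∫ θ in a..b, F' θ) t := by
  have h1 := (hasFDerivAt_integral_of_contDiff hF a b t).hasDerivAt
  have h2 : ∀ θ, F' θ = (fderiv ℝ F (t, θ)).comp (ContinuousLinearMap.inl ℝ ℝ ℝ) 1 := fun θ =>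
    (h θ).unique (((hF.differentiable one_ne_zero (t, θ)).hasFDerivAt).comp t
      (hasFDerivAt_prodMk_left t θ)).hasDerivAt
  rw [ContinuousLinearMap.intervalIntegral_apply] at h1
  · rwa [intervalIntegral.integral_congr fun θ _ => h2 θ]
  · refine Continuous.intervalIntegrable ?_ _ _
    exact ((hF.continuous_fderiv one_ne_zero).comp
      (by fun_prop : Continuous fun θ : ℝ => (t, θ))).clm_comp continuous_const

/-- Green's theorem on the unit square. -/
theorem integral_unit_square {f g : ℝ × ℝ → ℝ} (hf : ContDiff ℝ 1 f) (hg : ContDiff ℝ 1 g)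
    {w : ℝ → ℝ → ℝ} (hw : ∀ x y, ∃ f' g', HasDerivAt (fun s => f (x, s)) f' y ∧
      HasDerivAt (fun s => g (s, y)) g' x ∧ w x y = f' - g') :
    ∫ x in (0 : ℝ)..1, ∫ y in (0 : ℝ)..1, w x y =
      ((∫ x in (0 : ℝ)..1, f (x, 1)) - ∫ x in (0 : ℝ)..1, f (x, 0))
        - ((∫ y in (0 : ℝ)..1, g (1, y)) - ∫ y in (0 : ℝ)..1, g (0, y)) := by
  have h1 := MeasureTheory.integral2_divergence_prod_of_hasFDerivAt (fun q => -g q) f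
    (fun q => -fderiv ℝ g q) (fderiv ℝ f) 0 0 1 1 hg.continuous.neg.continuousOn
    hf.continuous.continuousOn
    (fun x _ => (hg.differentiable one_ne_zero x).hasFDerivAt.neg)
    (fun x _ => (hf.differentiable one_ne_zero x).hasFDerivAt)
    (ContinuousOn.integrableOn_compact (isCompact_uIcc.prod isCompact_uIcc)
      (Continuous.continuousOn
        ((((hg.continuous_fderiv one_ne_zero).neg.clm_apply continuous_const)).add
          ((hf.continuous_fderiv one_ne_zero).clm_apply continuous_const))))
  have h2 : ∀ x y, w x y = (-fderiv ℝ g (x, y)) (1, 0) + (fderiv ℝ f (x, y)) (0, 1) := by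
    intro x y
    obtain ⟨f', g', hf', hg', e⟩ := hw x y
    have e1 := hf'.unique (((hf.differentiable one_ne_zero (x, y)).hasFDerivAt).comp y
      (hasFDerivAt_prodMk_right x y)).hasDerivAt
    have e2 := hg'.unique (((hg.differentiable one_ne_zero (x, y)).hasFDerivAt).comp x
      (hasFDerivAt_prodMk_left x y)).hasDerivAt
    rw [e, e1, e2]
    simp
    ring
  simp only [h2, h1, intervalIntegral.integral_neg]
  ring

/-! ### Families of loops -/

/-- The derivative of a loop with respect to the parameter of the circle. -/
def derivLoop (h : Loop) : Loop :=
  ⟨deriv h.1, contDiff_deriv_loop h, periodic_deriv_loop h⟩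

theorem hasDerivAt_loop (h : Loop) (θ : ℝ) : HasDerivAt h.1 ((derivLoop h).1 θ) θ :=
  (h.2.differentiable (by simp) θ).hasDerivAt

theorem fderiv_fderiv_symm {V E : Type} [NormedAddCommGroup V] [NormedSpace ℝ V]
    [NormedAddCommGroup E] [NormedSpace ℝ E] {F : V → E} (hF : ContDiff ℝ ∞ F) (q a b : V) :
    fderiv ℝ (fun x => fderiv ℝ F x a) q b = fderiv ℝ (fun x => fderiv ℝ F x b) q a := by
  have h2 : Differentiable ℝ (fderiv ℝ F) :=
    (hF.fderiv_right (m := ∞) (by simp)).differentiable (by simp)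
  have h3 : ∀ c d, fderiv ℝ (fun x => fderiv ℝ F x c) q d = fderiv ℝ (fderiv ℝ F) q d c := by
    intro c d
    rw [fderiv_clm_apply (h2 q) (differentiableAt_const c)]
    simp
  rw [h3, h3]
  exact ((contDiff_infty.1 hF 2).contDiffAt.isSymmSndFDerivAt (by simp)) b a

section Family

variable {P : Type} [NormedAddCommGroup P] [NormedSpace ℝ P]

theorem contDiff_directional {V E : Type} [NormedAddCommGroup V] [NormedSpace ℝ V]
    [NormedAddCommGroup E] [NormedSpace ℝ E] {F : V → E} (hF : ContDiff ℝ ∞ F) (a : V) :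
    ContDiff ℝ ∞ fun x => fderiv ℝ F x a :=
  (hF.fderiv_right (m := ∞) (by simp)).clm_apply contDiff_const

/-- The partial derivative of a smooth family of loops in a direction of the parameter space. -/
def partialLoop {γ : P → Loop} (hγ : SmoothFamily γ) (v : P) (p : P) : Loop :=
  ⟨fun θ => fderiv ℝ (fun q : P × ℝ => (γ q.1).1 q.2) (p, θ) (v, 0),
    (contDiff_directional hγ (v, 0)).comp (contDiff_const.prodMk contDiff_id), fun θ => by
      have h1 : (fun q : P × ℝ => (γ (q + (0, 2 * Real.pi)).1).1 (q + (0, 2 * Real.pi)).2)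
          = fun q : P × ℝ => (γ q.1).1 q.2 := by
        funext q
        simp only [Prod.fst_add, Prod.snd_add, add_zero]
        exact (γ q.1).3 q.2
      have h2 := fderiv_comp_add_right (𝕜 := ℝ) (f := fun q : P × ℝ => (γ q.1).1 q.2)
        (x := (p, θ)) (0, 2 * Real.pi)
      rw [h1] at h2
      simp only [h2, Prod.mk_add_mk, add_zero]⟩

theorem SmoothFamily.partialLoop {γ : P → Loop} (hγ : SmoothFamily γ) (v : P) :
    SmoothFamily (partialLoop hγ v) :=
  contDiff_directional hγ (v, 0)

theorem SmoothFamily.comp {Q : Type} [NormedAddCommGroup Q] [NormedSpace ℝ Q] {γ : P → Loop}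
    (hγ : SmoothFamily γ) {f : Q → P} (hf : ContDiff ℝ ∞ f) : SmoothFamily fun q => γ (f q) :=
  ContDiff.comp (g := fun q : P × ℝ => (γ q.1).1 q.2) (f := fun q : Q × ℝ => (f q.1, q.2)) hγ
    ((hf.comp contDiff_fst).prodMk contDiff_snd)

theorem SmoothFamily.const (h : Loop) : SmoothFamily fun _ : P => h :=
  h.2.comp contDiff_snd

theorem SmoothFamily.smul {γ : P → Loop} (hγ : SmoothFamily γ) {f : P → ℝ}
    (hf : ContDiff ℝ ∞ f) : SmoothFamily fun p => f p • γ p :=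
  (hf.comp contDiff_fst).smul hγ

theorem hasVelocity_partialLoop {γ : P → Loop} (hγ : SmoothFamily γ) {f : ℝ → P} {v : P} {t : ℝ}
    (hf : HasDerivAt f v t) : HasVelocity (fun s => γ (f s)) t (partialLoop hγ v (f t)) := by
  intro θ
  have h1 : HasDerivAt (fun s => (f s, θ)) (v, (0 : ℝ)) t := hf.prodMk (hasDerivAt_const t θ)
  exact ((ContDiff.differentiable hγ (by simp) (f t, θ)).hasFDerivAt).comp_hasDerivAt t h1

/-- Prescribed velocity fields of a smooth family are thereby identified with `partialLoop`, and so
are smooth themselves. -/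
theorem HasVelocity.unique {γ : ℝ → Loop} {t : ℝ} {h k : Loop} (hh : HasVelocity γ t h)
    (hk : HasVelocity γ t k) : h = k :=
  Loop.ext (funext fun θ => (hh θ).unique (hk θ))

theorem derivLoop_eq_fderiv {γ : P → Loop} (hγ : SmoothFamily γ) (p : P) (θ : ℝ) :
    (derivLoop (γ p)).1 θ = fderiv ℝ (fun q : P × ℝ => (γ q.1).1 q.2) (p, θ) (0, 1) := by
  have h1 := ((ContDiff.differentiable hγ (by simp) (p, θ)).hasFDerivAt).comp_hasDerivAt θ
    ((hasDerivAt_const θ p).prodMk (hasDerivAt_id θ))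
  exact h1.deriv

theorem SmoothFamily.derivLoop {γ : P → Loop} (hγ : SmoothFamily γ) :
    SmoothFamily fun p => derivLoop (γ p) := by
  have h1 := contDiff_directional hγ (0, 1)
  unfold SmoothFamily
  simpa only [derivLoop_eq_fderiv hγ] using h1

theorem partialLoop_comm {γ : P → Loop} (hγ : SmoothFamily γ) (v w p : P) :
    partialLoop (hγ.partialLoop v) w p = partialLoop (hγ.partialLoop w) v p :=
  Loop.ext (funext fun θ => fderiv_fderiv_symm hγ (p, θ) (v, 0) (w, 0))

end Family

/-- By uniqueness the velocity is the partial derivative in the parameter, so this is the symmetry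
of the mixed second derivative in parameter and angle. -/
theorem HasVelocity.derivLoop {γ : ℝ → Loop} (hγ : SmoothFamily γ) {t : ℝ} {h : Loop}
    (hh : HasVelocity γ t h) :
    HasVelocity (fun s => derivLoop (γ s)) t (SpaceCurves.derivLoop h) := by
  have h1 : h = SpaceCurves.partialLoop hγ 1 t :=
    hh.unique (hasVelocity_partialLoop hγ (hasDerivAt_id t))
  have h2 : SpaceCurves.derivLoop h = SpaceCurves.partialLoop hγ.derivLoop 1 t := by
    apply Loop.ext
    funext θ
    rw [h1, derivLoop_eq_fderiv (hγ.partialLoop 1) t θ]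
    simp only [SpaceCurves.partialLoop, derivLoop_eq_fderiv hγ]
    exact fderiv_fderiv_symm hγ (t, θ) (1, 0) (0, 1)
  rw [h2]
  exact hasVelocity_partialLoop hγ.derivLoop (hasDerivAt_id t)

theorem HasVelocity.comp {γ : ℝ → Loop} {f : ℝ → ℝ} {r t : ℝ} {h : Loop}
    (hh : HasVelocity γ (f t) h) (hf : HasDerivAt f r t) :
    HasVelocity (fun s => γ (f s)) t (r • h) := fun θ =>
  (hh θ).scomp t hf

theorem continuous_family {P : Type} [NormedAddCommGroup P] [NormedSpace ℝ P] {γ : P → Loop}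
    (hγ : SmoothFamily γ) : Continuous fun p : P × ℝ => (γ p.1).1 p.2 :=
  ContDiff.continuous hγ

/-! ### Vector algebra in three-space -/

/-- The determinant of three vectors. -/
def det3 (u v w : E3) : ℝ := inner ℝ (cross3 u v) w

theorem inner_eq_coord (u v : E3) : inner ℝ u v = u 0 * v 0 + u 1 * v 1 + u 2 * v 2 := by
  simp [PiLp.inner_apply, Fin.sum_univ_three, mul_comm]

theorem cross3_zero (u v : E3) : (cross3 u v) 0 = u 1 * v 2 - u 2 * v 1 := by
  simp [cross3, cross_apply]

theorem cross3_one (u v : E3) : (cross3 u v) 1 = u 2 * v 0 - u 0 * v 2 := by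
  simp [cross3, cross_apply]

theorem cross3_two (u v : E3) : (cross3 u v) 2 = u 0 * v 1 - u 1 * v 0 := by
  simp [cross3, cross_apply]

theorem E3_ext {u v : E3} (h0 : u 0 = v 0) (h1 : u 1 = v 1) (h2 : u 2 = v 2) : u = v := by
  ext i
  fin_cases i
  exacts [h0, h1, h2]

theorem det3_eq_coord (u v w : E3) : det3 u v w =
    (u 1 * v 2 - u 2 * v 1) * w 0 + (u 2 * v 0 - u 0 * v 2) * w 1
      + (u 0 * v 1 - u 1 * v 0) * w 2 := by
  rw [det3, inner_eq_coord, cross3_zero, cross3_one, cross3_two]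

theorem det3_swap_left (u v w : E3) : det3 v u w = -det3 u v w := by
  simp only [det3_eq_coord]; ring

theorem det3_swap_right (u v w : E3) : det3 u w v = -det3 u v w := by
  simp only [det3_eq_coord]; ring

theorem det3_add_mid (u v v' w : E3) : det3 u (v + v') w = det3 u v w + det3 u v' w := by
  simp only [det3_eq_coord, PiLp.add_apply]; ring

theorem det3_add_right (u v w w' : E3) : det3 u v (w + w') = det3 u v w + det3 u v w' := by
  simp only [det3_eq_coord, PiLp.add_apply]; ring

theorem det3_smul_left (r : ℝ) (u v w : E3) : det3 (r • u) v w = r * det3 u v w := by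
  simp only [det3_eq_coord, PiLp.smul_apply, smul_eq_mul]; ring

theorem det3_smul_mid (r : ℝ) (u v w : E3) : det3 u (r • v) w = r * det3 u v w := by
  simp only [det3_eq_coord, PiLp.smul_apply, smul_eq_mul]; ring

theorem det3_smul_right (r : ℝ) (u v w : E3) : det3 u v (r • w) = r * det3 u v w := by
  simp only [det3_eq_coord, PiLp.smul_apply, smul_eq_mul]; ring

theorem det3_self_left (u w : E3) : det3 u u w = 0 := by
  simp only [det3_eq_coord]; ring

theorem det3_self_right (u v : E3) : det3 u v v = 0 := by
  simp only [det3_eq_coord]; ring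

theorem det3_self_outer (u v : E3) : det3 u v u = 0 := by
  simp only [det3_eq_coord]; ring

theorem det3_cross_mid (u v w k : E3) : det3 u (cross3 v w) k =
    inner ℝ u w * inner ℝ v k - inner ℝ u v * inner ℝ w k := by
  simp only [det3_eq_coord, inner_eq_coord, cross3_zero, cross3_one, cross3_two]; ring

theorem det3_cross_right (u v w k : E3) : det3 u v (cross3 w k) =
    inner ℝ u w * inner ℝ v k - inner ℝ u k * inner ℝ v w := by
  simp only [det3_eq_coord, inner_eq_coord, cross3_zero, cross3_one, cross3_two]; ring

theorem inner_cross3_left (u v : E3) : inner ℝ (cross3 u v) u = 0 := by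
  simp only [inner_eq_coord, cross3_zero, cross3_one, cross3_two]; ring

theorem inner_cross3_right (u v : E3) : inner ℝ (cross3 u v) v = 0 := by
  simp only [inner_eq_coord, cross3_zero, cross3_one, cross3_two]; ring

theorem cross3_smul_left (r : ℝ) (u v : E3) : cross3 (r • u) v = r • cross3 u v := by
  apply E3_ext <;>
    simp only [cross3_zero, cross3_one, cross3_two, PiLp.smul_apply, smul_eq_mul] <;> ring

theorem cross3_smul_right (r : ℝ) (u v : E3) : cross3 u (r • v) = r • cross3 u v := by
  apply E3_ext <;>
    simp only [cross3_zero, cross3_one, cross3_two, PiLp.smul_apply, smul_eq_mul] <;> ring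

theorem cross3_add_smul_self (r : ℝ) (u v : E3) : cross3 u (v + r • u) = cross3 u v := by
  apply E3_ext <;>
    simp only [cross3_zero, cross3_one, cross3_two, PiLp.smul_apply, PiLp.add_apply,
      smul_eq_mul] <;> ring

/-- A vector whose cross product with `u` vanishes is a multiple of `u`. -/
theorem eq_smul_of_cross3_eq_zero {u h : E3} (hu : u ≠ 0) (h0 : cross3 u h = 0) :
    h = (inner ℝ h u / inner ℝ u u) • u := by
  have hr : inner ℝ u u ≠ 0 := inner_self_ne_zero.2 hu
  have e0 : u 1 * h 2 - u 2 * h 1 = 0 := by rw [← cross3_zero, h0]; rfl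
  have e1 : u 2 * h 0 - u 0 * h 2 = 0 := by rw [← cross3_one, h0]; rfl
  have e2 : u 0 * h 1 - u 1 * h 0 = 0 := by rw [← cross3_two, h0]; rfl
  apply E3_ext <;> simp only [PiLp.smul_apply, smul_eq_mul] <;> rw [div_mul_eq_mul_div,
    eq_div_iff hr, inner_eq_coord, inner_eq_coord]
  -- These are the coordinates of `⟨u, u⟩ h - ⟨h, u⟩ u = (u × h) × u`.
  · linear_combination u 2 * e1 - u 1 * e2
  · linear_combination u 0 * e2 - u 2 * e0
  · linear_combination u 1 * e0 - u 0 * e1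

/-! ### Smoothness and derivatives of determinants, cross products and norms. -/

section Calculus

variable {V : Type} [NormedAddCommGroup V] [NormedSpace ℝ V]

theorem contDiff_coord {n : WithTop ℕ∞} {f : V → E3} (hf : ContDiff ℝ n f) (i : Fin 3) :
    ContDiff ℝ n fun x => f x i :=
  contDiff_euclidean.1 hf i

theorem contDiff_det3 {n : WithTop ℕ∞} {f g h : V → E3} (hf : ContDiff ℝ n f)
    (hg : ContDiff ℝ n g) (hh : ContDiff ℝ n h) : ContDiff ℝ n fun x => det3 (f x) (g x) (h x) := by
  have f' := contDiff_coord hf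
  have g' := contDiff_coord hg
  have h' := contDiff_coord hh
  simp only [det3_eq_coord]
  fun_prop

theorem continuous_det3 {X : Type} [TopologicalSpace X] {f g h : X → E3} (hf : Continuous f)
    (hg : Continuous g) (hh : Continuous h) : Continuous fun x => det3 (f x) (g x) (h x) := by
  simp only [det3_eq_coord]
  fun_prop

theorem continuous_cross3 {X : Type} [TopologicalSpace X] {f g : X → E3} (hf : Continuous f)
    (hg : Continuous g) : Continuous fun x => cross3 (f x) (g x) := by
  refine (PiLp.continuous_toLp 2 _).comp (continuous_pi fun i => ?_)
  fin_cases i <;> simp [cross_apply] <;> fun_prop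

theorem hasDerivAt_coord {f : ℝ → E3} {f' : E3} {t : ℝ} (hf : HasDerivAt f f' t) (i : Fin 3) :
    HasDerivAt (fun s => f s i) (f' i) t :=
  ((EuclideanSpace.proj i : E3 →L[ℝ] ℝ).hasFDerivAt).comp_hasDerivAt t hf

theorem hasDerivAt_E3 {f : ℝ → E3} {f' : E3} {t : ℝ}
    (h : ∀ i, HasDerivAt (fun s => f s i) (f' i) t) : HasDerivAt f f' t := by
  have h1 : HasDerivAt (fun s => (f s).ofLp) f'.ofLp t := hasDerivAt_pi.2 h
  exact ((PiLp.continuousLinearEquiv 2 ℝ fun _ : Fin 3 => ℝ).symm.toContinuousLinearMap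
    |>.hasFDerivAt).comp_hasDerivAt t h1

theorem hasDerivAt_det3 {f g h : ℝ → E3} {f' g' h' : E3} {t : ℝ} (hf : HasDerivAt f f' t)
    (hg : HasDerivAt g g' t) (hh : HasDerivAt h h' t) :
    HasDerivAt (fun s => det3 (f s) (g s) (h s))
      (det3 f' (g t) (h t) + det3 (f t) g' (h t) + det3 (f t) (g t) h') t := by
  have hf := hasDerivAt_coord hf
  have hg := hasDerivAt_coord hg
  have hh := hasDerivAt_coord hh
  simp only [det3_eq_coord]
  refine HasDerivAt.congr_deriv (((((hf 1).mul (hg 2)).sub ((hf 2).mul (hg 1))).mul (hh 0)).add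
    ((((hf 2).mul (hg 0)).sub ((hf 0).mul (hg 2))).mul (hh 1)) |>.add
    ((((hf 0).mul (hg 1)).sub ((hf 1).mul (hg 0))).mul (hh 2))) ?_
  simp only [Pi.mul_apply, Pi.sub_apply]
  ring

theorem hasDerivAt_cross3 {f g : ℝ → E3} {f' g' : E3} {t : ℝ} (hf : HasDerivAt f f' t)
    (hg : HasDerivAt g g' t) :
    HasDerivAt (fun s => cross3 (f s) (g s)) (cross3 f' (g t) + cross3 (f t) g') t := by
  have hf := hasDerivAt_coord hf
  have hg := hasDerivAt_coord hg
  refine hasDerivAt_E3 fun i => ?_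
  fin_cases i
  · simp only [Fin.zero_eta, PiLp.add_apply, cross3_zero]
    exact (((hf 1).mul (hg 2)).sub ((hf 2).mul (hg 1))).congr_deriv (by ring)
  · simp only [Fin.mk_one, PiLp.add_apply, cross3_one]
    exact (((hf 2).mul (hg 0)).sub ((hf 0).mul (hg 2))).congr_deriv (by ring)
  · simp only [Fin.reduceFinMk, PiLp.add_apply, cross3_two]
    exact (((hf 0).mul (hg 1)).sub ((hf 1).mul (hg 0))).congr_deriv (by ring)

theorem hasDerivAt_norm_of_ne_zero {f : ℝ → E3} {f' : E3} {t : ℝ} (hf : HasDerivAt f f' t)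
    (h0 : f t ≠ 0) : HasDerivAt (fun s => ‖f s‖) (‖f t‖⁻¹ * inner ℝ f' (f t)) t := by
  have h1 : ∀ s, ‖f s‖ = Real.sqrt (‖f s‖ ^ 2) := fun s => (Real.sqrt_sq (norm_nonneg _)).symm
  have h2 : ‖f t‖ ≠ 0 := norm_ne_zero_iff.2 h0
  have h3 := hf.norm_sq.sqrt (pow_ne_zero 2 h2)
  rw [← h1] at h3
  refine (h3.congr_deriv ?_).congr_of_eventuallyEq (Filter.Eventually.of_forall h1)
  rw [real_inner_comm]
  field_simp

end Calculus

/-! ### Integrals over the circle -/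

theorem integral_deriv_periodic {f f' : ℝ → ℝ} (hf : ∀ θ, HasDerivAt f (f' θ) θ)
    (hc : Continuous f') (hp : Function.Periodic f (2 * Real.pi)) :
    ∫ θ in (0 : ℝ)..(2 * Real.pi), f' θ = 0 := by
  rw [intervalIntegral.integral_eq_sub_of_hasDerivAt (fun θ _ => hf θ)
    (hc.intervalIntegrable _ _)]
  have := hp 0
  rw [zero_add] at this
  rw [this, sub_self]

theorem eq_zero_of_integral_eq_zero {f : ℝ → ℝ} (hf : Continuous f) (h0 : ∀ θ, 0 ≤ f θ)
    (hp : Function.Periodic f (2 * Real.pi))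
    (hi : ∫ θ in (0 : ℝ)..(2 * Real.pi), f θ = 0) (θ : ℝ) : f θ = 0 := by
  by_contra hne
  obtain ⟨z, hz, hfz⟩ := hp.exists_mem_Ico₀ Real.two_pi_pos θ
  have h1 := intervalIntegral.integral_pos Real.two_pi_pos hf.continuousOn (fun x _ => h0 x)
    ⟨z, ⟨hz.1, hz.2.le⟩, lt_of_le_of_ne (h0 z) (hfz ▸ Ne.symm hne)⟩
  exact h1.ne' hi

theorem norm_deriv_pos (c : Imm) (θ : ℝ) : 0 < ‖deriv c.1.1 θ‖ := norm_pos_iff.2 (c.2 θ)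

theorem norm_deriv_ne_zero (c : Imm) (θ : ℝ) : ‖deriv c.1.1 θ‖ ≠ 0 := (norm_deriv_pos c θ).ne'

theorem length_eq (c : Imm) : length c = ∫ θ in (0 : ℝ)..(2 * Real.pi), ‖deriv c.1.1 θ‖ := by
  simp only [length, arcInt, one_mul]

/-- The factor `|c'|` of `ds` cancels the one in `D_s c`. The integrand becomes trilinear in `c`,
`c'` and `h`, with no norm left to differentiate. -/
theorem liouville_idOp_eq (c : Imm) (h : Loop) : liouville idOp c h =
    ∫ θ in (0 : ℝ)..(2 * Real.pi), det3 (c.1.1 θ) (deriv c.1.1 θ) (h.1 θ) := by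
  refine intervalIntegral.integral_congr fun θ _ => ?_
  change det3 (c.1.1 θ) (‖deriv c.1.1 θ‖⁻¹ • deriv c.1.1 θ) (h.1 θ) * _ = _
  rw [det3_smul_mid]
  field_simp [norm_deriv_ne_zero c θ]

theorem OmegaMW_eq (c : Imm) (h k : Loop) : OmegaMW c h k =
    ∫ θ in (0 : ℝ)..(2 * Real.pi), det3 (deriv c.1.1 θ) (h.1 θ) (k.1 θ) := by
  refine intervalIntegral.integral_congr fun θ _ => ?_
  change det3 (‖deriv c.1.1 θ‖⁻¹ • deriv c.1.1 θ) (h.1 θ) (k.1 θ) * _ = _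
  rw [det3_smul_left]
  field_simp [norm_deriv_ne_zero c θ]

theorem dLength_apply (c : Imm) (h : Loop) :
    dLength c h = pairing c (Ds c h) (Ds c c.1) := rfl

theorem dLength_eq (c : Imm) (h : Loop) : dLength c h =
    ∫ θ in (0 : ℝ)..(2 * Real.pi), ‖deriv c.1.1 θ‖⁻¹ * inner ℝ (deriv h.1 θ) (deriv c.1.1 θ) := by
  refine intervalIntegral.integral_congr fun θ _ => ?_
  simp only [Ds, real_inner_smul_left, real_inner_smul_right]
  field_simp [norm_deriv_ne_zero c θ]

theorem pairing_comm (c : Imm) (h k : Loop) : pairing c h k = pairing c k h := by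
  simp only [pairing, real_inner_comm]

theorem inner_Ds_self (c : Imm) (θ : ℝ) :
    inner ℝ ((Ds c c.1).1 θ) ((Ds c c.1).1 θ) = 1 := by
  simp only [Ds, real_inner_smul_left, real_inner_smul_right]
  rw [real_inner_self_eq_norm_sq]
  field_simp [norm_deriv_ne_zero c θ]

theorem deriv_eq_smul_Ds (c : Imm) (h : Loop) (θ : ℝ) :
    deriv h.1 θ = ‖deriv c.1.1 θ‖ • (Ds c h).1 θ := by
  simp only [Ds, smul_smul]
  rw [mul_inv_cancel₀ (norm_deriv_ne_zero c θ), one_smul]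

/-- The unit tangent has constant length, so its derivative is orthogonal to it. -/
theorem inner_Ds_Ds_Ds (c : Imm) (θ : ℝ) :
    inner ℝ ((Ds c c.1).1 θ) ((Ds c (Ds c c.1)).1 θ) = 0 := by
  have h1 := (hasDerivAt_loop (Ds c c.1) θ).inner ℝ (hasDerivAt_loop (Ds c c.1) θ)
  simp only [inner_Ds_self] at h1
  have h2 := h1.unique (hasDerivAt_const θ 1)
  have h3 : (derivLoop (Ds c c.1)).1 θ = ‖deriv c.1.1 θ‖ • (Ds c (Ds c c.1)).1 θ :=
    deriv_eq_smul_Ds c _ θ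
  rw [h3, real_inner_smul_left, real_inner_smul_right, real_inner_comm] at h2
  have h4 := norm_deriv_ne_zero c θ
  have : ‖deriv c.1.1 θ‖ * (2 * inner ℝ ((Ds c c.1).1 θ) ((Ds c (Ds c c.1)).1 θ)) = 0 := by
    rw [real_inner_comm]; linarith
  simpa [h4] using this

/-- The variation of length in terms of the curvature vector. -/
theorem dLength_eq_neg_pairing (c : Imm) (h : Loop) :
    dLength c h = -pairing c h (Ds c (Ds c c.1)) := by
  -- Integration by parts: `⟨h, D_s c⟩` is periodic, so its derivative integrates to zero over the
  -- circle.
  have hd : ∀ θ, HasDerivAt (fun θ => inner ℝ (h.1 θ) ((Ds c c.1).1 θ))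
      (inner ℝ ((Ds c h).1 θ) ((Ds c c.1).1 θ) * ‖deriv c.1.1 θ‖
        + inner ℝ (h.1 θ) ((Ds c (Ds c c.1)).1 θ) * ‖deriv c.1.1 θ‖) θ := fun θ => by
    refine ((hasDerivAt_loop h θ).inner ℝ (hasDerivAt_loop (Ds c c.1) θ)).congr_deriv ?_
    rw [show (derivLoop h).1 θ = ‖deriv c.1.1 θ‖ • (Ds c h).1 θ from deriv_eq_smul_Ds c h θ,
      show (derivLoop (Ds c c.1)).1 θ = ‖deriv c.1.1 θ‖ • (Ds c (Ds c c.1)).1 θ from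
        deriv_eq_smul_Ds c _ θ, real_inner_smul_left, real_inner_smul_right]
    ring
  have hc : ∀ u v : Loop, Continuous fun θ => inner ℝ (u.1 θ) (v.1 θ) * ‖deriv c.1.1 θ‖ :=
    fun u v => ((continuous_loop u).inner (continuous_loop v)).mul (continuous_deriv_loop c.1).norm
  have h0 := integral_deriv_periodic hd ((hc _ _).add (hc _ _))
    (fun θ => by simp only [h.3 θ, (Ds c c.1).3 θ])
  rw [intervalIntegral.integral_add ((hc _ _).intervalIntegrable _ _)
    ((hc _ _).intervalIntegrable _ _)] at h0
  exact eq_neg_of_add_eq_zero_left h0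

/-! ### The forms as linear maps -/

theorem continuous_det3_loop (u v w : Loop) :
    Continuous fun θ => det3 (u.1 θ) (v.1 θ) (w.1 θ) :=
  continuous_det3 (continuous_loop u) (continuous_loop v) (continuous_loop w)

/-- The Liouville form as a linear map. -/
def liouvilleLin (c : Imm) : Loop →ₗ[ℝ] ℝ where
  toFun := liouville idOp c
  map_add' h k := by
    simp only [liouville_idOp_eq]
    rw [← intervalIntegral.integral_add]
    · exact intervalIntegral.integral_congr fun θ _ => det3_add_right _ _ _ _
    all_goals exact (continuous_det3_loop c.1 (derivLoop c.1) _).intervalIntegrable _ _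
  map_smul' r h := by
    simp only [liouville_idOp_eq, RingHom.id_apply, smul_eq_mul]
    rw [← intervalIntegral.integral_const_mul]
    exact intervalIntegral.integral_congr fun θ _ => det3_smul_right _ _ _ _

/-- The Marsden-Weinstein form as a bilinear map. -/
def marsdenWeinstein (c : Imm) : Loop →ₗ[ℝ] Loop →ₗ[ℝ] ℝ :=
  LinearMap.mk₂ ℝ (OmegaMW c)
    (fun h h' k => by
      simp only [OmegaMW_eq]
      rw [← intervalIntegral.integral_add]
      · exact intervalIntegral.integral_congr fun θ _ => det3_add_mid _ _ _ _
      all_goals exact (continuous_det3_loop (derivLoop c.1) _ _).intervalIntegrable _ _)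
    (fun r h k => by
      simp only [OmegaMW_eq, smul_eq_mul]
      rw [← intervalIntegral.integral_const_mul]
      exact intervalIntegral.integral_congr fun θ _ => det3_smul_mid _ _ _ _)
    (fun h k k' => by
      simp only [OmegaMW_eq]
      rw [← intervalIntegral.integral_add]
      · exact intervalIntegral.integral_congr fun θ _ => det3_add_right _ _ _ _
      all_goals exact (continuous_det3_loop (derivLoop c.1) _ _).intervalIntegrable _ _)
    (fun r h k => by
      simp only [OmegaMW_eq, smul_eq_mul]
      rw [← intervalIntegral.integral_const_mul]
      exact intervalIntegral.integral_congr fun θ _ => det3_smul_right _ _ _ _)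

theorem marsdenWeinstein_apply (c : Imm) (h k : Loop) :
    marsdenWeinstein c h k = OmegaMW c h k := rfl

theorem liouvilleLin_apply (c : Imm) (h : Loop) : liouvilleLin c h = liouville idOp c h := rfl

/-- The closed formula for the two-form of the operator field `Φ(ℓ) id`. -/
def lengthForm (Φ : ℝ → ℝ) (c : Imm) : Loop →ₗ[ℝ] Loop →ₗ[ℝ] ℝ :=
  (3 * Φ (length c)) • marsdenWeinstein c
    - deriv Φ (length c) • ((dLength c).smulRight (liouvilleLin c)
      - (liouvilleLin c).smulRight (dLength c))

theorem lengthForm_apply (Φ : ℝ → ℝ) (c : Imm) (h k : Loop) : lengthForm Φ c h k =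
    3 * Φ (length c) * OmegaMW c h k - deriv Φ (length c) *
      (dLength c h * liouville idOp c k - liouville idOp c h * dLength c k) := by
  simp only [lengthForm, LinearMap.sub_apply, LinearMap.smul_apply, smul_eq_mul,
    LinearMap.smulRight_apply, marsdenWeinstein_apply, liouvilleLin_apply]

theorem OmegaMW_swap (c : Imm) (h k : Loop) : OmegaMW c k h = -OmegaMW c h k := by
  rw [OmegaMW_eq, OmegaMW_eq, ← intervalIntegral.integral_neg]
  exact intervalIntegral.integral_congr fun θ _ => det3_swap_right _ _ _

theorem lengthForm_swap (Φ : ℝ → ℝ) (c : Imm) (h k : Loop) :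
    lengthForm Φ c k h = -lengthForm Φ c h k := by
  rw [lengthForm_apply, lengthForm_apply, OmegaMW_swap]; ring

theorem lengthForm_self (Φ : ℝ → ℝ) (c : Imm) (h : Loop) : lengthForm Φ c h h = 0 := by
  have := lengthForm_swap Φ c h h
  linarith

/-! ### Vertical fields, the scaling field and the binormal field -/

theorem OmegaMW_vertical {c : Imm} {v : Loop} (hv : v ∈ vertical c) (k : Loop) :
    OmegaMW c v k = 0 := by
  obtain ⟨a, -, -, hv⟩ := hv
  rw [OmegaMW_eq]
  simp [hv, det3_smul_mid, det3_self_left]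

theorem liouville_vertical {c : Imm} {v : Loop} (hv : v ∈ vertical c) :
    liouville idOp c v = 0 := by
  obtain ⟨a, -, -, hv⟩ := hv
  rw [liouville_idOp_eq]
  simp [hv, det3_smul_right, det3_self_right]

theorem dLength_vertical {c : Imm} {v : Loop} (hv : v ∈ vertical c) : dLength c v = 0 := by
  obtain ⟨a, -, -, hv⟩ := hv
  have h0 : ∀ θ, inner ℝ (v.1 θ) ((Ds c (Ds c c.1)).1 θ) = 0 := fun θ => by
    rw [hv, deriv_eq_smul_Ds c c.1, smul_smul, real_inner_smul_left, inner_Ds_Ds_Ds, mul_zero]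
  rw [dLength_eq_neg_pairing, pairing, arcInt]
  simp [h0]

theorem lengthForm_vertical (Φ : ℝ → ℝ) {c : Imm} {v : Loop} (hv : v ∈ vertical c) (k : Loop) :
    lengthForm Φ c v k = 0 := by
  rw [lengthForm_apply, OmegaMW_vertical hv, liouville_vertical hv, dLength_vertical hv]; ring

/-- With `T = D_s c` a unit vector orthogonal to `D_s T`, one has `det(T, T × D_s T, k) = -⟨D_s T,
k⟩`, the integrand of the variation of length. -/
theorem OmegaMW_binormal (c : Imm) (k : Loop) : OmegaMW c (binormal c) k = dLength c k := by
  rw [dLength_eq_neg_pairing, pairing_comm, OmegaMW_eq, pairing, arcInt,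
    ← intervalIntegral.integral_neg]
  refine intervalIntegral.integral_congr fun θ _ => ?_
  simp only [binormal, crossLoop, det3_cross_mid]
  rw [deriv_eq_smul_Ds c c.1, real_inner_smul_left, real_inner_smul_left, inner_Ds_Ds_Ds,
    inner_Ds_self, norm_smul, norm_norm]
  rw [show ‖(Ds c c.1).1 θ‖ = 1 by
    rw [← sq_eq_sq₀ (norm_nonneg _) zero_le_one, ← real_inner_self_eq_norm_sq, inner_Ds_self,
      one_pow]]
  ring

/-- Lagrange's identity reduces the integrand to `-⟨c, D_s² c⟩ |c'|`. Its integral is `dℓ_c(c)`,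
which equals `ℓ_c` by homogeneity. -/
theorem liouville_binormal (c : Imm) : liouville idOp c (binormal c) = length c := by
  rw [← dLength_self, dLength_eq_neg_pairing, liouville_idOp_eq, pairing, arcInt,
    ← intervalIntegral.integral_neg]
  refine intervalIntegral.integral_congr fun θ _ => ?_
  simp only [binormal, crossLoop, det3_cross_right]
  have h1 : inner ℝ (deriv c.1.1 θ) ((Ds c (Ds c c.1)).1 θ) = 0 := by
    rw [deriv_eq_smul_Ds c c.1, real_inner_smul_left, inner_Ds_Ds_Ds, mul_zero]
  have h2 : inner ℝ (deriv c.1.1 θ) ((Ds c c.1).1 θ) = ‖deriv c.1.1 θ‖ := by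
    conv_lhs => rw [deriv_eq_smul_Ds c c.1, real_inner_smul_left, inner_Ds_self, mul_one]
  rw [h1, h2]
  ring

theorem dLength_binormal (c : Imm) : dLength c (binormal c) = 0 := by
  rw [dLength_eq_neg_pairing, pairing, arcInt]
  simp [binormal, crossLoop, inner_cross3_right]

theorem pairing_binormal_vertical {c : Imm} {v : Loop} (hv : v ∈ vertical c) :
    pairing c (binormal c) v = 0 := by
  obtain ⟨a, -, -, hv⟩ := hv
  have h0 : ∀ θ, inner ℝ ((binormal c).1 θ) (v.1 θ) = 0 := fun θ => by
    rw [hv, deriv_eq_smul_Ds c c.1, smul_smul, real_inner_smul_right]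
    simp only [binormal, crossLoop, inner_cross3_left, mul_zero]
  rw [pairing, arcInt]
  simp [h0]

/-- The counterpart of `OmegaMW_binormal`: under `Ω^MW` the binormal field is dual to `dℓ` and the
scaling field to `-Θ`. -/
theorem OmegaMW_scale (c : Imm) (k : Loop) : OmegaMW c c.1 k = -liouville idOp c k := by
  rw [OmegaMW_eq, liouville_idOp_eq, ← intervalIntegral.integral_neg]
  exact intervalIntegral.integral_congr fun θ _ => det3_swap_left _ _ _

theorem liouville_scale (c : Imm) : liouville idOp c c.1 = 0 := by
  rw [liouville_idOp_eq]
  simp [det3_self_outer]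

/-- Since `dℓ(X) = 0` and `Θ(X) = ℓ`, both terms of the form contract to multiples of `dℓ`. Their
total coefficient is the factor that decides degeneracy; it reappears in `lengthForm_scale`. -/
theorem lengthForm_binormal (Φ : ℝ → ℝ) (c : Imm) (k : Loop) : lengthForm Φ c (binormal c) k =
    (3 * Φ (length c) + length c * deriv Φ (length c)) * dLength c k := by
  rw [lengthForm_apply, OmegaMW_binormal, dLength_binormal, liouville_binormal]; ring

theorem lengthForm_scale (Φ : ℝ → ℝ) (c : Imm) (k : Loop) : lengthForm Φ c c.1 k =
    -((3 * Φ (length c) + length c * deriv Φ (length c)) * liouville idOp c k) := by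
  rw [lengthForm_apply, OmegaMW_scale, dLength_self, liouville_scale]; ring

/-- The kernel of the Marsden-Weinstein form is the vertical space. -/
theorem mem_vertical_of_cross3 {c : Imm} {h : Loop}
    (h0 : ∀ θ, cross3 (deriv c.1.1 θ) (h.1 θ) = 0) : h ∈ vertical c := by
  have hd := contDiff_deriv_loop c.1
  refine ⟨fun θ => inner ℝ (h.1 θ) (deriv c.1.1 θ) / inner ℝ (deriv c.1.1 θ) (deriv c.1.1 θ),
    (h.2.inner ℝ hd).div (hd.inner ℝ hd) fun θ => inner_self_ne_zero.2 (c.2 θ), fun θ => ?_,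
    fun θ => eq_smul_of_cross3_eq_zero (c.2 θ) (h0 θ)⟩
  simp only [h.3 θ, periodic_deriv_loop c.1 θ]

theorem cross3_of_mem_vertical {c : Imm} {h : Loop} (hh : h ∈ vertical c) (θ : ℝ) :
    cross3 (deriv c.1.1 θ) (h.1 θ) = 0 := by
  obtain ⟨a, -, -, hv⟩ := hh
  rw [hv, cross3_smul_right]
  have : cross3 (deriv c.1.1 θ) (deriv c.1.1 θ) = 0 := by
    apply E3_ext <;> simp only [cross3_zero, cross3_one, cross3_two, PiLp.zero_apply] <;> ring
  rw [this, smul_zero]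

/-- Testing against `k = c' × h` gives `∫ |c' × h|² dθ = 0`, hence `c' × h = 0` pointwise. -/
theorem mem_vertical_of_OmegaMW {c : Imm} {h : Loop} (h0 : ∀ k, OmegaMW c h k = 0) :
    h ∈ vertical c := by
  refine mem_vertical_of_cross3 fun θ => ?_
  have h1 := h0 (crossLoop (derivLoop c.1) h)
  rw [OmegaMW_eq] at h1
  have hp : Function.Periodic (fun θ => det3 ((derivLoop c.1).1 θ) (h.1 θ)
      ((crossLoop (derivLoop c.1) h).1 θ)) (2 * Real.pi) := fun θ => by
    simp only [h.3 θ, (derivLoop c.1).3 θ, (crossLoop (derivLoop c.1) h).3 θ]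
  have h2 := eq_zero_of_integral_eq_zero
    (continuous_det3_loop (derivLoop c.1) h (crossLoop (derivLoop c.1) h))
    (fun θ => real_inner_self_nonneg) hp h1 θ
  exact inner_self_eq_zero.1 h2

theorem eq_zero_of_pairing_self {c : Imm} {h : Loop} (h0 : pairing c h h = 0) : h = 0 := by
  apply Loop.ext
  funext θ
  have hp : Function.Periodic (fun θ => inner ℝ (h.1 θ) (h.1 θ) * ‖deriv c.1.1 θ‖)
      (2 * Real.pi) := fun θ => by simp only [h.3 θ, periodic_deriv_loop c.1 θ]
  have h2 := eq_zero_of_integral_eq_zero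
    (((continuous_loop h).inner (continuous_loop h)).mul (continuous_deriv_loop c.1).norm)
    (fun θ => mul_nonneg real_inner_self_nonneg (norm_nonneg _)) hp h0 θ
  exact inner_self_eq_zero.1 ((mul_eq_zero.1 h2).resolve_right (norm_deriv_ne_zero c θ))

/-- On such `h` only the Marsden-Weinstein term survives, with the non-zero coefficient `3Φ`. -/
theorem mem_vertical_of_lengthForm {Φ : ℝ → ℝ} {c : Imm} {h : Loop} (hpos : 0 < Φ (length c))
    (hl : dLength c h = 0) (hΘ : liouville idOp c h = 0) (h0 : ∀ k, lengthForm Φ c h k = 0) :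
    h ∈ vertical c := by
  refine mem_vertical_of_OmegaMW fun k => ?_
  have := h0 k
  rw [lengthForm_apply, hl, hΘ] at this
  have h3 : Φ (length c) * OmegaMW c h k = 0 := by linarith
  exact (mul_eq_zero.1 h3).resolve_left hpos.ne'

theorem scale_notMem_vertical (c : Imm) : c.1 ∉ vertical c := fun h =>
  (length_pos c).ne' ((dLength_self c).symm.trans (dLength_vertical h))

/-- The kernel of the form is the vertical space where `x³ Φ(x)` has non-zero derivative. -/
theorem lengthForm_nondeg_iff {Φ : ℝ → ℝ} {c : Imm} (hpos : 0 < Φ (length c)) :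
    (∀ h, (∀ k, lengthForm Φ c h k = 0) → h ∈ vertical c) ↔
      3 * Φ (length c) + length c * deriv Φ (length c) ≠ 0 := by
  constructor
  · intro H h0
    -- If the factor vanished, the scaling field would be a non-vertical kernel vector.
    refine scale_notMem_vertical c (H c.1 fun k => ?_)
    rw [lengthForm_scale, h0, zero_mul, neg_zero]
  · intro hne h h0
    -- Testing against the binormal field yields `dℓ(h) = 0`, and against the scaling field `Θ(h) =
    -- 0`.
    refine mem_vertical_of_lengthForm hpos ?_ ?_ h0
    · have := h0 (binormal c)
      rw [lengthForm_swap, lengthForm_binormal, neg_eq_zero] at this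
      exact (mul_eq_zero.1 this).resolve_left hne
    · have := h0 c.1
      rw [lengthForm_swap, lengthForm_scale, neg_neg] at this
      exact (mul_eq_zero.1 this).resolve_left hne

/-- The one-forms `dℓ` and `Θ` vanish on vertical fields, and their matrix on the pair `(I, X)` is
`ℓ` times the identity. -/
theorem scale_binormal_independent {c : Imm} {a b : ℝ}
    (h : a • c.1 + b • binormal c ∈ vertical c) : a = 0 ∧ b = 0 := by
  have h1 := dLength_vertical h
  have h2 : liouvilleLin c (a • c.1 + b • binormal c) = 0 := liouville_vertical h
  rw [map_add, map_smul, map_smul, dLength_self, dLength_binormal] at h1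
  rw [map_add, map_smul, map_smul, liouvilleLin_apply, liouvilleLin_apply, liouville_scale,
    liouville_binormal] at h2
  have h0 := (length_pos c).ne'
  constructor
  · simpa [h0] using h1
  · simpa [h0] using h2

/-- Where `x³ Φ(x)` has zero derivative, the kernel is spanned by the vertical space, the scaling
field and the binormal field. -/
theorem mem_vertical_sup_of_lengthForm {Φ : ℝ → ℝ} {c : Imm} {h : Loop} (hpos : 0 < Φ (length c))
    (hz : 3 * Φ (length c) + length c * deriv Φ (length c) = 0)
    (h0 : ∀ k, lengthForm Φ c h k = 0) :
    ∃ a b : ℝ, h - (a • c.1 + b • binormal c) ∈ vertical c := by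
  have hl := (length_pos c).ne'
  -- The coefficients are chosen so that both `dℓ` and `Θ` vanish on the difference.
  refine ⟨dLength c h / length c, liouville idOp c h / length c,
    mem_vertical_of_lengthForm hpos ?_ ?_ fun k => ?_⟩
  · simp only [map_sub, map_add, map_smul, dLength_self, dLength_binormal, smul_eq_mul]
    field_simp
    ring
  · rw [← liouvilleLin_apply]
    simp only [map_sub, map_add, map_smul, liouvilleLin_apply, liouville_scale,
      liouville_binormal, smul_eq_mul]
    field_simp
    ring
  · simp only [map_sub, map_add, map_smul, LinearMap.sub_apply, LinearMap.add_apply,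
      LinearMap.smul_apply, lengthForm_scale, lengthForm_binormal, hz, h0 k]
    simp

/-! ### Smooth dependence on the curve -/

section Family

variable {P : Type} [NormedAddCommGroup P] [NormedSpace ℝ P]

theorem contDiff_speed {γ : P → Imm} (hγ : SmoothFamily fun p => (γ p).1) :
    ContDiff ℝ ∞ fun q : P × ℝ => ‖deriv (γ q.1).1.1 q.2‖ :=
  ContDiff.norm ℝ hγ.derivLoop fun q => (γ q.1).2 q.2

theorem contDiff_length {γ : P → Imm} (hγ : SmoothFamily fun p => (γ p).1) :
    ContDiff ℝ ∞ fun p => length (γ p) := by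
  simp only [length_eq]
  exact contDiff_integral (contDiff_speed hγ) _ _

theorem contDiff_liouville {γ : P → Imm} (hγ : SmoothFamily fun p => (γ p).1) {κ : P → Loop}
    (hκ : SmoothFamily κ) : ContDiff ℝ ∞ fun p => liouville idOp (γ p) (κ p) := by
  simp only [liouville_idOp_eq]
  exact contDiff_integral (contDiff_det3 hγ hγ.derivLoop hκ) _ _

theorem contDiff_OmegaMW {γ : P → Imm} (hγ : SmoothFamily fun p => (γ p).1) {κ μ : P → Loop}
    (hκ : SmoothFamily κ) (hμ : SmoothFamily μ) :
    ContDiff ℝ ∞ fun p => OmegaMW (γ p) (κ p) (μ p) := by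
  simp only [OmegaMW_eq]
  exact contDiff_integral (contDiff_det3 hγ.derivLoop hκ hμ) _ _

theorem contDiff_dLength {γ : P → Imm} (hγ : SmoothFamily fun p => (γ p).1) {κ : P → Loop}
    (hκ : SmoothFamily κ) : ContDiff ℝ ∞ fun p => dLength (γ p) (κ p) := by
  simp only [dLength_eq]
  exact contDiff_integral (((contDiff_speed hγ).inv fun q => norm_deriv_ne_zero _ _).mul
    (ContDiff.inner ℝ hκ.derivLoop hγ.derivLoop)) _ _

theorem contDiff_comp_length {Φ : ℝ → ℝ} (hΦ : ContDiffOn ℝ 1 Φ (Set.Ioi 0)) {γ : P → Imm}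
    (hγ : SmoothFamily fun p => (γ p).1) : ContDiff ℝ 1 fun p => Φ (length (γ p)) :=
  contDiff_iff_contDiffAt.2 fun p => ContDiffAt.comp p
    (hΦ.contDiffAt (isOpen_Ioi.mem_nhds (length_pos (γ p))))
    ((contDiff_length hγ).of_le (by simp)).contDiffAt

/-- Continuity is all that a `C¹` weight gives, because `Φ'` enters the form. For this reason
closedness and leaf invariance are proved by integration and not by differentiating the form. -/
theorem continuous_lengthForm {Φ : ℝ → ℝ} (hΦ : ContDiffOn ℝ 1 Φ (Set.Ioi 0)) {γ : P → Imm}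
    (hγ : SmoothFamily fun p => (γ p).1) {κ μ : P → Loop}
    (hκ : SmoothFamily κ) (hμ : SmoothFamily μ) :
    Continuous fun p => lengthForm Φ (γ p) (κ p) (μ p) := by
  simp only [lengthForm_apply]
  have h1 : Continuous fun p => deriv Φ (length (γ p)) :=
    (hΦ.continuousOn_deriv_of_isOpen isOpen_Ioi le_rfl).comp_continuous
      (contDiff_length hγ).continuous fun p => length_pos _
  exact ((continuous_const.mul (contDiff_comp_length hΦ hγ).continuous).mul
    (contDiff_OmegaMW hγ hκ hμ).continuous).sub (h1.mul
      (((contDiff_dLength hγ hκ).continuous.mul (contDiff_liouville hγ hμ).continuous).sub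
        ((contDiff_liouville hγ hκ).continuous.mul (contDiff_dLength hγ hμ).continuous)))

end Family

theorem liouville_lengthOp (Φ : ℝ → ℝ) (c : Imm) (h : Loop) :
    liouville (lengthOp Φ) c h = Φ (length c) * liouville idOp c h :=
  (liouvilleLin c).map_smul (Φ (length c)) h

/-! ### Derivatives along paths -/

theorem hasDerivAt_length {γ : ℝ → Imm} (hγ : SmoothFamily fun t => (γ t).1) {t : ℝ} {h : Loop}
    (hh : HasVelocity (fun s => (γ s).1) t h) :
    HasDerivAt (fun s => length (γ s)) (dLength (γ t) h) t := by
  simp only [length_eq, dLength_eq]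
  exact hasDerivAt_integral ((contDiff_speed hγ).of_le (by simp)) (fun θ =>
    hasDerivAt_norm_of_ne_zero (hh.derivLoop hγ θ) ((γ t).2 θ)) _ _

/-- The variation of the Liouville form `Θ^id(k)` in the direction `h`. -/
def dLiouville (c : Imm) (h k : Loop) : ℝ := ∫ θ in (0 : ℝ)..(2 * Real.pi),
  (det3 (h.1 θ) (deriv c.1.1 θ) (k.1 θ) + det3 (c.1.1 θ) (deriv h.1 θ) (k.1 θ))

theorem hasDerivAt_liouville {γ : ℝ → Imm} (hγ : SmoothFamily fun t => (γ t).1) {κ : ℝ → Loop}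
    (hκ : SmoothFamily κ) {t : ℝ} {h k : Loop} (hh : HasVelocity (fun s => (γ s).1) t h)
    (hk : HasVelocity κ t k) :
    HasDerivAt (fun s => liouville idOp (γ s) (κ s))
      (dLiouville (γ t) h (κ t) + liouville idOp (γ t) k) t := by
  simp only [liouville_idOp_eq, dLiouville]
  refine HasDerivAt.congr_deriv ?_ (intervalIntegral.integral_add
    (((continuous_det3_loop h (derivLoop (γ t).1) (κ t)).add
      (continuous_det3_loop (γ t).1 (derivLoop h) (κ t))).intervalIntegrable _ _)
    ((continuous_det3_loop (γ t).1 (derivLoop (γ t).1) k).intervalIntegrable _ _))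
  exact hasDerivAt_integral ((contDiff_det3 hγ hγ.derivLoop hκ).of_le (by simp)) (fun θ =>
    hasDerivAt_det3 (hh θ) (hh.derivLoop hγ θ) (hk θ)) _ _

/-- The exterior derivative of the Liouville form is a multiple of the Marsden-Weinstein form. -/
theorem dLiouville_antisymm (c : Imm) (h k : Loop) :
    dLiouville c k h - dLiouville c h k = 3 * OmegaMW c h k := by
  have hd : ∀ θ, HasDerivAt (fun θ => det3 (c.1.1 θ) (k.1 θ) (h.1 θ))
      (det3 (deriv c.1.1 θ) (k.1 θ) (h.1 θ) + det3 (c.1.1 θ) (deriv k.1 θ) (h.1 θ)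
        + det3 (c.1.1 θ) (k.1 θ) (deriv h.1 θ)) θ := fun θ =>
    hasDerivAt_det3 (hasDerivAt_loop c.1 θ) (hasDerivAt_loop k θ) (hasDerivAt_loop h θ)
  have hc := ((continuous_det3_loop (derivLoop c.1) k h).add
    (continuous_det3_loop c.1 (derivLoop k) h)).add (continuous_det3_loop c.1 k (derivLoop h))
  have hp : Function.Periodic (fun θ => det3 (c.1.1 θ) (k.1 θ) (h.1 θ)) (2 * Real.pi) :=
    fun θ => by simp only [c.1.3 θ, h.3 θ, k.3 θ]
  have h0 := integral_deriv_periodic hd hc hp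
  have hi : ∀ u v w : Loop, IntervalIntegrable (fun θ => det3 (u.1 θ) (v.1 θ) (w.1 θ))
      MeasureTheory.volume 0 (2 * Real.pi) := fun u v w =>
    (continuous_det3_loop u v w).intervalIntegrable _ _
  -- After the vanishing integral of the derivative of `det(c, k, h)` is added, the two sides agree
  -- pointwise. The terms without derivatives of `h` and `k` give two copies of `det(c', h, k)`; the
  -- third comes from the integration by parts.
  rw [← add_zero (3 * OmegaMW c h k), ← h0, OmegaMW_eq, ← intervalIntegral.integral_const_mul]
  refine (intervalIntegral.integral_sub ((hi k (derivLoop c.1) h).add (hi c.1 (derivLoop k) h))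
      ((hi h (derivLoop c.1) k).add (hi c.1 (derivLoop h) k))).symm.trans (Eq.trans ?_
    (intervalIntegral.integral_add ((hi (derivLoop c.1) h k).const_mul 3)
      (hc.intervalIntegrable _ _)))
  refine intervalIntegral.integral_congr fun θ _ => ?_
  simp only [det3_eq_coord, derivLoop]
  ring

theorem hasDerivAt_liouville_lengthOp {Φ : ℝ → ℝ} (hΦ : ContDiffOn ℝ 1 Φ (Set.Ioi 0))
    {γ : ℝ → Imm} (hγ : SmoothFamily fun t => (γ t).1) {κ : ℝ → Loop}
    (hκ : SmoothFamily κ) {t : ℝ} {h k : Loop} (hh : HasVelocity (fun s => (γ s).1) t h)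
    (hk : HasVelocity κ t k) :
    HasDerivAt (fun s => liouville (lengthOp Φ) (γ s) (κ s))
      (deriv Φ (length (γ t)) * dLength (γ t) h * liouville idOp (γ t) (κ t)
        + Φ (length (γ t)) * (dLiouville (γ t) h (κ t) + liouville idOp (γ t) k)) t := by
  simp only [liouville_lengthOp]
  have h1 : HasDerivAt Φ (deriv Φ (length (γ t))) (length (γ t)) :=
    ((hΦ.contDiffAt (isOpen_Ioi.mem_nhds (length_pos (γ t)))).differentiableAt
      one_ne_zero).hasDerivAt
  exact (HasDerivAt.comp t h1 (hasDerivAt_length hγ hh)).mul (hasDerivAt_liouville hγ hκ hh hk)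

theorem hasVelocity_const (k : Loop) (t : ℝ) : HasVelocity (fun _ => k) t 0 := fun θ =>
  hasDerivAt_const t (k.1 θ)

theorem hasDirDeriv_length (c : Imm) (h : Loop) : HasDirDeriv length c h (dLength c h) := by
  rintro γ hγ rfl hh
  exact hasDerivAt_length hγ hh

theorem hasDirDeriv_liouville (c : Imm) (h k : Loop) :
    HasDirDeriv (fun b => liouville idOp b k) c h (dLiouville c h k) := by
  rintro γ hγ rfl hh
  have := hasDerivAt_liouville hγ (SmoothFamily.const k) hh (hasVelocity_const k 0)
  rwa [← liouvilleLin_apply, map_zero, add_zero] at this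

theorem hasDirDeriv_liouville_lengthOp {Φ : ℝ → ℝ} (hΦ : ContDiffOn ℝ 1 Φ (Set.Ioi 0))
    (c : Imm) (h k : Loop) : HasDirDeriv (fun b => liouville (lengthOp Φ) b k) c h
      (deriv Φ (length c) * dLength c h * liouville idOp c k
        + Φ (length c) * dLiouville c h k) := by
  rintro γ hγ rfl hh
  have := hasDerivAt_liouville_lengthOp hΦ hγ (SmoothFamily.const k) hh (hasVelocity_const k 0)
  rwa [← liouvilleLin_apply (γ 0) 0, map_zero, add_zero] at this

theorem HasDirDeriv.dirDeriv_eq {F : Imm → ℝ} {c : Imm} {h : Loop} {a : ℝ}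
    (ha : HasDirDeriv F c h a) : dirDeriv F c h = a :=
  (Classical.epsilon_spec (p := HasDirDeriv F c h) ⟨a, ha⟩).unique ha

theorem Omega_idOp (c : Imm) (h k : Loop) : Omega idOp c h k = 3 * OmegaMW c h k := by
  rw [Omega, (hasDirDeriv_liouville c h k).dirDeriv_eq,
    (hasDirDeriv_liouville c k h).dirDeriv_eq, ← dLiouville_antisymm]
  ring

theorem Omega_lengthOp {Φ : ℝ → ℝ} (hΦ : ContDiffOn ℝ 1 Φ (Set.Ioi 0)) (c : Imm) (h k : Loop) :
    Omega (lengthOp Φ) c h k = lengthForm Φ c h k := by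
  rw [Omega, (hasDirDeriv_liouville_lengthOp hΦ c h k).dirDeriv_eq,
    (hasDirDeriv_liouville_lengthOp hΦ c k h).dirDeriv_eq, lengthForm_apply]
  linear_combination Φ (length c) * dLiouville_antisymm c h k

/-! ### Closedness and invariance along the kernel -/

theorem contDiff_liouville_lengthOp {P : Type} [NormedAddCommGroup P] [NormedSpace ℝ P]
    {Φ : ℝ → ℝ} (hΦ : ContDiffOn ℝ 1 Φ (Set.Ioi 0)) {γ : P → Imm}
    (hγ : SmoothFamily fun p => (γ p).1) {κ : P → Loop} (hκ : SmoothFamily κ) :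
    ContDiff ℝ 1 fun p => liouville (lengthOp Φ) (γ p) (κ p) := by
  simp only [liouville_lengthOp]
  exact (contDiff_comp_length hΦ hγ).mul ((contDiff_liouville hγ hκ).of_le (by simp))

/-- Stokes' theorem for the Liouville form on a parametrized square of curves. -/
theorem integral_lengthForm_square {Φ : ℝ → ℝ} (hΦ : ContDiffOn ℝ 1 Φ (Set.Ioi 0))
    {γ : ℝ × ℝ → Imm} {ξ η : ℝ × ℝ → Loop} (hγ : SmoothFamily fun p => (γ p).1)
    (hξ : ∀ x y, HasVelocity (fun s => (γ (s, y)).1) x (ξ (x, y)))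
    (hη : ∀ x y, HasVelocity (fun s => (γ (x, s)).1) y (η (x, y))) :
    ∫ x in (0 : ℝ)..1, ∫ y in (0 : ℝ)..1, lengthForm Φ (γ (x, y)) (ξ (x, y)) (η (x, y)) =
      ((∫ x in (0 : ℝ)..1, liouville (lengthOp Φ) (γ (x, 1)) (ξ (x, 1)))
        - ∫ x in (0 : ℝ)..1, liouville (lengthOp Φ) (γ (x, 0)) (ξ (x, 0)))
      - ((∫ y in (0 : ℝ)..1, liouville (lengthOp Φ) (γ (1, y)) (η (1, y)))
        - ∫ y in (0 : ℝ)..1, liouville (lengthOp Φ) (γ (0, y)) (η (0, y))) := by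
  have hl : ∀ x y : ℝ, HasDerivAt (fun s : ℝ => (s, y)) ((1 : ℝ), (0 : ℝ)) x := fun x y =>
    (hasDerivAt_id x).prodMk (hasDerivAt_const x y)
  have hr : ∀ x y : ℝ, HasDerivAt (fun s : ℝ => (x, s)) ((0 : ℝ), (1 : ℝ)) y := fun x y =>
    (hasDerivAt_const y x).prodMk (hasDerivAt_id y)
  obtain rfl : ξ = partialLoop hγ (1, 0) := funext fun p =>
    (hξ p.1 p.2).unique (hasVelocity_partialLoop hγ (hl p.1 p.2))
  obtain rfl : η = partialLoop hγ (0, 1) := funext fun p =>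
    (hη p.1 p.2).unique (hasVelocity_partialLoop hγ (hr p.1 p.2))
  have sξ := hγ.partialLoop (1, 0)
  have sη := hγ.partialLoop (0, 1)
  refine integral_unit_square (contDiff_liouville_lengthOp hΦ hγ sξ)
    (contDiff_liouville_lengthOp hΦ hγ sη) fun x y => ?_
  have cl : ContDiff ℝ ∞ fun s : ℝ => (s, y) := contDiff_id.prodMk contDiff_const
  have cr : ContDiff ℝ ∞ fun s : ℝ => (x, s) := contDiff_const.prodMk contDiff_id
  refine ⟨_, _,
    hasDerivAt_liouville_lengthOp hΦ (γ := fun s => γ (x, s))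
      (hγ.comp cr) (sξ.comp cr) (hη x y) (hasVelocity_partialLoop sξ (hr x y)),
    hasDerivAt_liouville_lengthOp hΦ (γ := fun s => γ (s, y))
      (hγ.comp cl) (sη.comp cl) (hξ x y) (hasVelocity_partialLoop sη (hl x y)), ?_⟩
  -- The two terms in which `Θ` is applied to a mixed second derivative of `γ` are equal and cancel.
  rw [partialLoop_comm hγ (1, 0) (0, 1), lengthForm_apply]
  linear_combination (-Φ (length (γ (x, y)))) * dLiouville_antisymm (γ (x, y))
    (partialLoop hγ (1, 0) (x, y)) (partialLoop hγ (0, 1) (x, y))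

/-- The integral of the form over the boundary of a cube vanishes. -/
theorem integral_lengthForm_cube {Φ : ℝ → ℝ} (hΦ : ContDiffOn ℝ 1 Φ (Set.Ioi 0))
    {γ : ℝ × ℝ × ℝ → Imm} {ξ η ζ : ℝ × ℝ × ℝ → Loop} (hγ : SmoothFamily fun p => (γ p).1)
    (hξ : ∀ x y z, HasVelocity (fun s => (γ (s, y, z)).1) x (ξ (x, y, z)))
    (hη : ∀ x y z, HasVelocity (fun s => (γ (x, s, z)).1) y (η (x, y, z)))
    (hζ : ∀ x y z, HasVelocity (fun s => (γ (x, y, s)).1) z (ζ (x, y, z))) :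
    (∫ x in (0 : ℝ)..1, ∫ y in (0 : ℝ)..1,
        (lengthForm Φ (γ (x, y, 1)) (ξ (x, y, 1)) (η (x, y, 1))
          - lengthForm Φ (γ (x, y, 0)) (ξ (x, y, 0)) (η (x, y, 0))))
      + (∫ y in (0 : ℝ)..1, ∫ z in (0 : ℝ)..1,
        (lengthForm Φ (γ (1, y, z)) (η (1, y, z)) (ζ (1, y, z))
          - lengthForm Φ (γ (0, y, z)) (η (0, y, z)) (ζ (0, y, z))))
      + (∫ z in (0 : ℝ)..1, ∫ x in (0 : ℝ)..1,
        (lengthForm Φ (γ (x, 1, z)) (ζ (x, 1, z)) (ξ (x, 1, z))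
          - lengthForm Φ (γ (x, 0, z)) (ζ (x, 0, z)) (ξ (x, 0, z)))) = 0 := by
  obtain rfl : ξ = partialLoop hγ (1, 0, 0) := funext fun p =>
    (hξ p.1 p.2.1 p.2.2).unique (hasVelocity_partialLoop hγ
      ((hasDerivAt_id p.1).prodMk (hasDerivAt_const p.1 p.2)))
  obtain rfl : η = partialLoop hγ (0, 1, 0) := funext fun p =>
    (hη p.1 p.2.1 p.2.2).unique (hasVelocity_partialLoop hγ ((hasDerivAt_const p.2.1 p.1).prodMk
      ((hasDerivAt_id p.2.1).prodMk (hasDerivAt_const p.2.1 p.2.2))))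
  obtain rfl : ζ = partialLoop hγ (0, 0, 1) := funext fun p =>
    (hζ p.1 p.2.1 p.2.2).unique (hasVelocity_partialLoop hγ ((hasDerivAt_const p.2.2 p.1).prodMk
      ((hasDerivAt_const p.2.2 p.2.1).prodMk (hasDerivAt_id p.2.2))))
  have split : ∀ f g : ℝ × ℝ → ℝ, Continuous f → Continuous g →
      ∫ x in (0 : ℝ)..1, ∫ y in (0 : ℝ)..1, (f (x, y) - g (x, y)) =
        (∫ x in (0 : ℝ)..1, ∫ y in (0 : ℝ)..1, f (x, y))
          - ∫ x in (0 : ℝ)..1, ∫ y in (0 : ℝ)..1, g (x, y) := by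
    intro f g hf hg
    rw [← intervalIntegral.integral_sub
      ((continuous_integral_param hf 0 1).intervalIntegrable _ _)
      ((continuous_integral_param hg 0 1).intervalIntegrable _ _)]
    refine intervalIntegral.integral_congr fun x _ => intervalIntegral.integral_sub ?_ ?_
    · exact (hf.comp (by fun_prop : Continuous fun y : ℝ => (x, y))).intervalIntegrable _ _
    · exact (hg.comp (by fun_prop : Continuous fun y : ℝ => (x, y))).intervalIntegrable _ _
  have cont : ∀ v w, Continuous fun p =>
      lengthForm Φ (γ p) (partialLoop hγ v p) (partialLoop hγ w p) := fun v w =>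
    continuous_lengthForm hΦ hγ (hγ.partialLoop v) (hγ.partialLoop w)
  have cxy : ∀ z : ℝ, ContDiff ℝ ∞ fun q : ℝ × ℝ => (q.1, q.2, z) := fun z => by fun_prop
  have cyz : ∀ x : ℝ, ContDiff ℝ ∞ fun q : ℝ × ℝ => (x, q.1, q.2) := fun z => by fun_prop
  have czx : ∀ y : ℝ, ContDiff ℝ ∞ fun q : ℝ × ℝ => (q.2, y, q.1) := fun z => by fun_prop
  have sxy := split (fun q => lengthForm Φ (γ (q.1, q.2, 1)) (partialLoop hγ (1, 0, 0) (q.1, q.2, 1))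
      (partialLoop hγ (0, 1, 0) (q.1, q.2, 1)))
    (fun q => lengthForm Φ (γ (q.1, q.2, 0)) (partialLoop hγ (1, 0, 0) (q.1, q.2, 0))
      (partialLoop hγ (0, 1, 0) (q.1, q.2, 0)))
    ((cont _ _).comp (cxy 1).continuous) ((cont _ _).comp (cxy 0).continuous)
  have syz := split (fun q => lengthForm Φ (γ (1, q.1, q.2)) (partialLoop hγ (0, 1, 0) (1, q.1, q.2))
      (partialLoop hγ (0, 0, 1) (1, q.1, q.2)))
    (fun q => lengthForm Φ (γ (0, q.1, q.2)) (partialLoop hγ (0, 1, 0) (0, q.1, q.2))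
      (partialLoop hγ (0, 0, 1) (0, q.1, q.2)))
    ((cont _ _).comp (cyz 1).continuous) ((cont _ _).comp (cyz 0).continuous)
  have szx := split (fun q => lengthForm Φ (γ (q.2, 1, q.1)) (partialLoop hγ (0, 0, 1) (q.2, 1, q.1))
      (partialLoop hγ (1, 0, 0) (q.2, 1, q.1)))
    (fun q => lengthForm Φ (γ (q.2, 0, q.1)) (partialLoop hγ (0, 0, 1) (q.2, 0, q.1))
      (partialLoop hγ (1, 0, 0) (q.2, 0, q.1)))
    ((cont _ _).comp (czx 1).continuous) ((cont _ _).comp (czx 0).continuous)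
  have fxy := fun z => integral_lengthForm_square hΦ (hγ.comp (cxy z))
    (γ := fun q => γ (q.1, q.2, z)) (ξ := fun q => partialLoop hγ (1, 0, 0) (q.1, q.2, z))
    (η := fun q => partialLoop hγ (0, 1, 0) (q.1, q.2, z)) (fun x y => hξ x y z) (fun x y => hη x y z)
  have fyz := fun x => integral_lengthForm_square hΦ (hγ.comp (cyz x))
    (γ := fun q => γ (x, q.1, q.2)) (ξ := fun q => partialLoop hγ (0, 1, 0) (x, q.1, q.2))
    (η := fun q => partialLoop hγ (0, 0, 1) (x, q.1, q.2)) (fun y z => hη x y z) (fun y z => hζ x y z)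
  have fzx := fun y => integral_lengthForm_square hΦ (hγ.comp (czx y))
    (γ := fun q => γ (q.2, y, q.1)) (ξ := fun q => partialLoop hγ (0, 0, 1) (q.2, y, q.1))
    (η := fun q => partialLoop hγ (1, 0, 0) (q.2, y, q.1)) (fun z x => hζ x y z) (fun z x => hξ x y z)
  beta_reduce at sxy syz szx fxy fyz fzx
  -- The six faces produce four edge integrals each. Every one of the twelve edges occurs twice,
  -- with opposite signs.
  rw [sxy, syz, szx, fxy, fxy, fyz, fyz, fzx, fzx]
  ring

/-- The form is invariant along the directions of its kernel. -/
theorem lengthForm_leaf_inv {Φ : ℝ → ℝ} (hΦ : ContDiffOn ℝ 1 Φ (Set.Ioi 0))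
    {γ : ℝ × ℝ × ℝ → Imm} {τ ξ η : ℝ × ℝ × ℝ → Loop} (hγ : SmoothFamily fun p => (γ p).1)
    (hτ : ∀ t x y, HasVelocity (fun s => (γ (s, x, y)).1) t (τ (t, x, y)))
    (hξ : ∀ t x y, HasVelocity (fun s => (γ (t, s, y)).1) x (ξ (t, x, y)))
    (hη : ∀ t x y, HasVelocity (fun s => (γ (t, x, s)).1) y (η (t, x, y)))
    (hker : ∀ t x y, lengthForm Φ (γ (t, x, y)) (τ (t, x, y)) (ξ (t, x, y)) = 0 ∧
      lengthForm Φ (γ (t, x, y)) (τ (t, x, y)) (η (t, x, y)) = 0) (t t' x y : ℝ) :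
    lengthForm Φ (γ (t, x, y)) (ξ (t, x, y)) (η (t, x, y)) =
      lengthForm Φ (γ (t', x, y)) (ξ (t', x, y)) (η (t', x, y)) := by
  have sξ : SmoothFamily ξ := by
    obtain rfl : ξ = partialLoop hγ (0, 1, 0) := funext fun p =>
      (hξ p.1 p.2.1 p.2.2).unique (hasVelocity_partialLoop hγ ((hasDerivAt_const p.2.1 p.1).prodMk
        ((hasDerivAt_id p.2.1).prodMk (hasDerivAt_const p.2.1 p.2.2))))
    exact hγ.partialLoop _
  have sη : SmoothFamily η := by
    obtain rfl : η = partialLoop hγ (0, 0, 1) := funext fun p =>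
      (hη p.1 p.2.1 p.2.2).unique (hasVelocity_partialLoop hγ ((hasDerivAt_const p.2.2 p.1).prodMk
        ((hasDerivAt_const p.2.2 p.2.1).prodMk (hasDerivAt_id p.2.2))))
    exact hγ.partialLoop _
  set G : ℝ × ℝ × ℝ → ℝ := fun p => lengthForm Φ (γ p) (ξ p) (η p) with hG
  have cG : Continuous G := continuous_lengthForm hΦ hγ sξ sη
  have aff : ∀ a r s : ℝ, HasDerivAt (fun s : ℝ => a + s * r) r s := fun a r s => by
    simpa using ((hasDerivAt_id s).mul_const r).const_add a
  -- The square with corner `(x, y)` and side `ε` is swept from `t` to `t'`. The four side faces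
  -- contain the kernel direction `τ` and contribute nothing, so the integrals over the two ends
  -- agree; the common factor `ε²` is divided out.
  have key : ∀ ε : ℝ, ε ≠ 0 → ∫ u in (0 : ℝ)..1, ∫ v in (0 : ℝ)..1,
      (G (t', x + u * ε, y + v * ε) - G (t, x + u * ε, y + v * ε)) = 0 := by
    intro ε hε
    have hs : ContDiff ℝ ∞ fun p : ℝ × ℝ × ℝ =>
        (t + p.1 * (t' - t), x + p.2.1 * ε, y + p.2.2 * ε) := by fun_prop
    have h1 := integral_lengthForm_cube hΦ
      (γ := fun p => γ (t + p.1 * (t' - t), x + p.2.1 * ε, y + p.2.2 * ε))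
      (ξ := fun p => (t' - t) • τ (t + p.1 * (t' - t), x + p.2.1 * ε, y + p.2.2 * ε))
      (η := fun p => ε • ξ (t + p.1 * (t' - t), x + p.2.1 * ε, y + p.2.2 * ε))
      (ζ := fun p => ε • η (t + p.1 * (t' - t), x + p.2.1 * ε, y + p.2.2 * ε))
      (hγ.comp hs)
      (fun a b d => HasVelocity.comp (γ := fun s => (γ (s, x + b * ε, y + d * ε)).1)
        (hτ _ _ _) (aff t (t' - t) a))
      (fun a b d => HasVelocity.comp
        (γ := fun s => (γ (t + a * (t' - t), s, y + d * ε)).1) (hξ _ _ _) (aff x ε b))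
      (fun a b d => HasVelocity.comp
        (γ := fun s => (γ (t + a * (t' - t), x + b * ε, s)).1) (hη _ _ _) (aff y ε d))
    simp only [map_smul, LinearMap.smul_apply, smul_eq_mul, (hker _ _ _).1,
      lengthForm_swap Φ _ _ (η _), (hker _ _ _).2, mul_zero, neg_zero, sub_zero,
      intervalIntegral.integral_zero, zero_add, add_zero, one_mul, zero_mul,
      add_sub_cancel] at h1
    have h2 : ∀ u v : ℝ, ε * (ε * G (t', x + u * ε, y + v * ε))
        - ε * (ε * G (t, x + u * ε, y + v * ε)) =
        ε ^ 2 * (G (t', x + u * ε, y + v * ε) - G (t, x + u * ε, y + v * ε)) := fun u v => by ring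
    have h3 : ∫ u in (0 : ℝ)..1, ∫ v in (0 : ℝ)..1,
        ε ^ 2 * (G (t', x + u * ε, y + v * ε) - G (t, x + u * ε, y + v * ε)) = 0 := by
      refine Eq.trans ?_ h1
      exact intervalIntegral.integral_congr fun u _ =>
        intervalIntegral.integral_congr fun v _ => (h2 u v).symm
    simp only [intervalIntegral.integral_const_mul] at h3
    exact (mul_eq_zero.1 h3).resolve_left (pow_ne_zero 2 hε)
  -- The averaged difference is continuous in `ε` and vanishes off `0`. At `ε = 0` it is the
  -- difference of the values at the corner itself.
  have cD : Continuous fun ε : ℝ => ∫ u in (0 : ℝ)..1, ∫ v in (0 : ℝ)..1,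
      (G (t', x + u * ε, y + v * ε) - G (t, x + u * ε, y + v * ε)) := by
    refine continuous_integral_param (F := fun q : ℝ × ℝ => ∫ v in (0 : ℝ)..1,
      (G (t', x + q.2 * q.1, y + v * q.1) - G (t, x + q.2 * q.1, y + v * q.1))) ?_ 0 1
    refine continuous_integral_param (F := fun q : (ℝ × ℝ) × ℝ =>
      (G (t', x + q.1.2 * q.1.1, y + q.2 * q.1.1)
        - G (t, x + q.1.2 * q.1.1, y + q.2 * q.1.1))) ?_ 0 1
    fun_prop
  have h0 := congrFun (cD.ext_on (dense_compl_singleton (0 : ℝ)) continuous_const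
    (fun ε hε => key ε hε)) 0
  simp only [mul_zero, add_zero, intervalIntegral.integral_const, sub_zero, one_smul] at h0
  exact (sub_eq_zero.1 h0).symm

/-! ### Reparametrization -/

theorem hasDerivAt_diffPlus (φ : DiffPlus) (θ : ℝ) :
    HasDerivAt φ.toFun (deriv φ.toFun θ) θ :=
  (φ.smooth.differentiable (by simp) θ).hasDerivAt

theorem deriv_reparam (h : Loop) (φ : DiffPlus) (θ : ℝ) :
    deriv (reparam h φ).1 θ = deriv φ.toFun θ • deriv h.1 (φ.toFun θ) :=
  ((hasDerivAt_loop h (φ.toFun θ)).scomp θ (hasDerivAt_diffPlus φ θ)).deriv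

theorem deriv_imm_reparam (c : Imm) (φ : DiffPlus) (θ : ℝ) :
    deriv (c.reparam φ).1.1 θ = deriv φ.toFun θ • deriv c.1.1 (φ.toFun θ) :=
  deriv_reparam c.1 φ θ

/-- Substitution leads to an integral over `[φ(0), φ(0) + 2π]`, which periodicity shifts back to
`[0, 2π]`. -/
theorem integral_reparam {f : ℝ → ℝ} (hf : Continuous f)
    (hp : Function.Periodic f (2 * Real.pi)) (φ : DiffPlus) :
    ∫ θ in (0 : ℝ)..(2 * Real.pi), f (φ.toFun θ) * deriv φ.toFun θ =
      ∫ θ in (0 : ℝ)..(2 * Real.pi), f θ := by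
  have h1 := intervalIntegral.integral_comp_mul_deriv (a := 0) (b := 2 * Real.pi)
    (fun θ _ => hasDerivAt_diffPlus φ θ)
    (φ.smooth.continuous_deriv (by simp)).continuousOn hf
  have h2 := hp.intervalIntegral_add_eq (φ.toFun 0) 0
  have h3 := φ.map_add 0
  rw [zero_add] at h2 h3
  rw [h3, h2] at h1
  exact h1

theorem norm_deriv_reparam (c : Imm) (φ : DiffPlus) (θ : ℝ) :
    ‖deriv (c.reparam φ).1.1 θ‖ = ‖deriv c.1.1 (φ.toFun θ)‖ * deriv φ.toFun θ := by
  rw [deriv_imm_reparam, norm_smul, Real.norm_of_nonneg (φ.deriv_pos θ).le, mul_comm]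

theorem length_reparam (c : Imm) (φ : DiffPlus) : length (c.reparam φ) = length c := by
  rw [length_eq, length_eq, ← integral_reparam (continuous_deriv_loop c.1).norm
    (fun θ => by simp only [periodic_deriv_loop c.1 θ]) φ]
  exact intervalIntegral.integral_congr fun θ _ => norm_deriv_reparam c φ θ

theorem liouville_reparam (c : Imm) (h : Loop) (φ : DiffPlus) :
    liouville idOp (c.reparam φ) (reparam h φ) = liouville idOp c h := by
  have hp : Function.Periodic (fun θ => det3 (c.1.1 θ) (deriv c.1.1 θ) (h.1 θ)) (2 * Real.pi) :=
    fun θ => by simp only [periodic_deriv_loop c.1 θ, c.1.3 θ, h.3 θ]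
  rw [liouville_idOp_eq, liouville_idOp_eq,
    ← integral_reparam (f := fun θ => det3 (c.1.1 θ) (deriv c.1.1 θ) (h.1 θ))
      (continuous_det3_loop c.1 (derivLoop c.1) h) hp φ]
  refine intervalIntegral.integral_congr fun θ _ => ?_
  beta_reduce
  rw [deriv_imm_reparam, det3_smul_mid, mul_comm]
  rfl

theorem OmegaMW_reparam (c : Imm) (h k : Loop) (φ : DiffPlus) :
    OmegaMW (c.reparam φ) (reparam h φ) (reparam k φ) = OmegaMW c h k := by
  have hp : Function.Periodic (fun θ => det3 (deriv c.1.1 θ) (h.1 θ) (k.1 θ)) (2 * Real.pi) :=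
    fun θ => by simp only [periodic_deriv_loop c.1 θ, h.3 θ, k.3 θ]
  rw [OmegaMW_eq, OmegaMW_eq,
    ← integral_reparam (f := fun θ => det3 (deriv c.1.1 θ) (h.1 θ) (k.1 θ))
      (continuous_det3_loop (derivLoop c.1) h k) hp φ]
  refine intervalIntegral.integral_congr fun θ _ => ?_
  beta_reduce
  rw [deriv_imm_reparam, det3_smul_left, mul_comm]
  rfl

theorem dLength_reparam (c : Imm) (h : Loop) (φ : DiffPlus) :
    dLength (c.reparam φ) (reparam h φ) = dLength c h := by
  have hp : Function.Periodic (fun θ => ‖deriv c.1.1 θ‖⁻¹ *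
      inner ℝ (deriv h.1 θ) (deriv c.1.1 θ)) (2 * Real.pi) :=
    fun θ => by simp only [periodic_deriv_loop c.1 θ, periodic_deriv_loop h θ]
  rw [dLength_eq, dLength_eq, ← integral_reparam
    (f := fun θ => ‖deriv c.1.1 θ‖⁻¹ * inner ℝ (deriv h.1 θ) (deriv c.1.1 θ))
    (((continuous_deriv_loop c.1).norm.inv₀ (norm_deriv_ne_zero c)).mul
      ((continuous_deriv_loop h).inner (continuous_deriv_loop c.1))) hp φ]
  refine intervalIntegral.integral_congr fun θ _ => ?_
  have h1 := (φ.deriv_pos θ).ne'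
  have h2 := norm_deriv_ne_zero c (φ.toFun θ)
  beta_reduce
  rw [norm_deriv_reparam, deriv_imm_reparam, deriv_reparam, real_inner_smul_left,
    real_inner_smul_right]
  field_simp

theorem lengthForm_reparam (Φ : ℝ → ℝ) (c : Imm) (h k : Loop) (φ : DiffPlus) :
    lengthForm Φ (c.reparam φ) (reparam h φ) (reparam k φ) = lengthForm Φ c h k := by
  simp only [lengthForm_apply, length_reparam, liouville_reparam, OmegaMW_reparam,
    dLength_reparam]

/-! ### Scaling -/

/-- The rescaled immersion `r c`. -/
def scaleImm (r : ℝ) (hr : 0 < r) (c : Imm) : Imm :=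
  ⟨r • c.1, fun θ => by
    rw [deriv_loop_smul]
    exact smul_ne_zero hr.ne' (c.2 θ)⟩

theorem normalize_eq_scaleImm (c : Imm) :
    normalize c = scaleImm (length c)⁻¹ (inv_pos.2 (length_pos c)) c := rfl

section Scale

variable {r : ℝ} (hr : 0 < r) (c : Imm)

theorem deriv_scaleImm (θ : ℝ) : deriv (scaleImm r hr c).1.1 θ = r • deriv c.1.1 θ :=
  deriv_loop_smul r c.1 θ

theorem norm_deriv_scaleImm (θ : ℝ) :
    ‖deriv (scaleImm r hr c).1.1 θ‖ = r * ‖deriv c.1.1 θ‖ := by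
  rw [deriv_scaleImm, norm_smul, Real.norm_of_nonneg hr.le]

theorem length_scaleImm : length (scaleImm r hr c) = r * length c := by
  simp only [length_eq, norm_deriv_scaleImm, intervalIntegral.integral_const_mul]

theorem OmegaMW_scaleImm (h k : Loop) : OmegaMW (scaleImm r hr c) h k = r * OmegaMW c h k := by
  simp only [OmegaMW_eq, deriv_scaleImm, det3_smul_left, intervalIntegral.integral_const_mul]

theorem Ds_scaleImm (h : Loop) : Ds (scaleImm r hr c) h = r⁻¹ • Ds c h := by
  apply Loop.ext
  funext θ
  change ‖deriv (scaleImm r hr c).1.1 θ‖⁻¹ • deriv h.1 θ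
    = r⁻¹ • (‖deriv c.1.1 θ‖⁻¹ • deriv h.1 θ)
  rw [norm_deriv_scaleImm, mul_inv, mul_smul]

/-- The unit tangent is scale invariant, and the one remaining arclength derivative has weight `-1`.
-/
theorem binormal_scaleImm : binormal (scaleImm r hr c) = r⁻¹ • binormal c := by
  have h1 : Ds (scaleImm r hr c) (scaleImm r hr c).1 = Ds c c.1 := by
    rw [Ds_scaleImm, scaleImm, Ds_smul, smul_smul, inv_mul_cancel₀ hr.ne', one_smul]
  rw [binormal, h1, Ds_scaleImm]
  apply Loop.ext
  funext θ
  exact cross3_smul_right _ _ _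

theorem vertical_scaleImm : vertical (scaleImm r hr c) = vertical c := by
  have key : ∀ θ h, cross3 (deriv (scaleImm r hr c).1.1 θ) h = r • cross3 (deriv c.1.1 θ) h :=
    fun θ h => by rw [deriv_scaleImm, cross3_smul_left]
  ext h
  constructor <;> intro hh <;> refine mem_vertical_of_cross3 fun θ => ?_
  · have := cross3_of_mem_vertical hh θ
    rw [key] at this
    exact (smul_eq_zero.1 this).resolve_left hr.ne'
  · rw [key, cross3_of_mem_vertical hh θ, smul_zero]

end Scale

theorem binormal_normalize (c : Imm) : binormal (normalize c) = length c • binormal c := by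
  rw [normalize_eq_scaleImm, binormal_scaleImm, inv_inv]

theorem vertical_normalize (c : Imm) : vertical (normalize c) = vertical c :=
  vertical_scaleImm (inv_pos.2 (length_pos c)) c

theorem OmegaMW_normalize (c : Imm) (h k : Loop) :
    OmegaMW (normalize c) h k = (length c)⁻¹ * OmegaMW c h k :=
  OmegaMW_scaleImm (inv_pos.2 (length_pos c)) c h k

theorem normalize_of_length_eq_one {c : Imm} (hc : length c = 1) : normalize c = c := by
  apply Subtype.ext
  change (length c)⁻¹ • c.1 = c.1
  rw [hc, inv_one, one_smul]

theorem normalize_reparam (c : Imm) (φ : DiffPlus) :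
    normalize (c.reparam φ) = (normalize c).reparam φ := by
  apply Subtype.ext
  change (length (c.reparam φ))⁻¹ • reparam c.1 φ = reparam ((length c)⁻¹ • c.1) φ
  rw [length_reparam]
  rfl

/-! ### Derivatives of fields -/

theorem smoothFamily_normalize {P : Type} [NormedAddCommGroup P] [NormedSpace ℝ P] {γ : P → Imm}
    (hγ : SmoothFamily fun p => (γ p).1) : SmoothFamily fun p => (normalize (γ p)).1 :=
  hγ.smul ((contDiff_length hγ).inv fun _ => (length_pos _).ne')

theorem hasVelocity_normalize {γ : ℝ → Imm} (hγ : SmoothFamily fun t => (γ t).1) {t : ℝ}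
    {h : Loop} (hh : HasVelocity (fun s => (γ s).1) t h) :
    HasVelocity (fun s => (normalize (γ s)).1) t (dNormalize (γ t) h).1 := by
  intro θ
  refine (((hasDerivAt_length hγ hh).inv (length_pos _).ne').smul (hh θ)).congr_deriv ?_
  change _ = (length (γ t))⁻¹ • h.1 θ
    - (dLength (γ t) h / length (γ t) ^ 2) • (γ t).1.1 θ
  simp only [Pi.inv_apply]
  rw [neg_div, neg_smul, sub_eq_add_neg]

/-- Differentiating the normalising factor of the unit tangent only adds a multiple of `c'`, which
the cross product with `c'` kills. -/
theorem binormal_apply (c : Imm) (θ : ℝ) : (binormal c).1 θ =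
    (‖deriv c.1.1 θ‖ ^ 3)⁻¹ • cross3 (deriv c.1.1 θ) (deriv (deriv c.1.1) θ) := by
  have hv : HasDerivAt (deriv c.1.1) (deriv (deriv c.1.1) θ) θ := hasDerivAt_loop (derivLoop c.1) θ
  have h1 := ((hasDerivAt_norm_of_ne_zero hv (c.2 θ)).inv (norm_deriv_ne_zero c θ)).smul hv
  have h2 : deriv (Ds c c.1).1 θ = _ := h1.deriv
  change cross3 (‖deriv c.1.1 θ‖⁻¹ • deriv c.1.1 θ) (‖deriv c.1.1 θ‖⁻¹ • deriv (Ds c c.1).1 θ) = _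
  rw [h2, cross3_smul_right, cross3_smul_left, cross3_add_smul_self, Pi.inv_apply,
    cross3_smul_right, smul_smul, smul_smul]
  congr 1
  field_simp

/-- The infinitesimal form of homogeneity of degree `-1`: in direction `c` the cross product `c' ×
c''` contributes the weight `2` and `|c'|⁻³` the weight `-3`. -/
theorem hasFieldDeriv_binormal (c : Imm) : HasFieldDeriv binormal c c.1 (-binormal c) := by
  rintro γ hγ rfl hh θ
  have hu : HasDerivAt (fun s => deriv (γ s).1.1 θ) (deriv (γ 0).1.1 θ) 0 := hh.derivLoop hγ θ
  have hv : HasDerivAt (fun s => deriv (deriv (γ s).1.1) θ) (deriv (deriv (γ 0).1.1) θ) 0 :=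
    (hh.derivLoop hγ).derivLoop hγ.derivLoop θ
  simp only [binormal_apply]
  have h0 := norm_deriv_ne_zero (γ 0) θ
  refine ((((hasDerivAt_norm_of_ne_zero hu ((γ 0).2 θ)).pow 3).inv (pow_ne_zero 3 h0)).smul
    (hasDerivAt_cross3 hu hv)).congr_deriv ?_
  change _ = -(binormal (γ 0)).1 θ
  rw [binormal_apply, real_inner_self_eq_norm_sq]
  simp only [Pi.inv_apply, Pi.pow_apply]
  rw [← two_smul ℝ (cross3 _ _), smul_smul, ← add_smul, ← neg_smul]
  congr 1
  field_simp
  ring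

/-! ### Fields in the kernel -/

/-- Because `(x³Φ)' = x²(3Φ + xΦ')`, the function `x³Φ` is constant on the interval; `C` is its
value at the midpoint. -/
theorem eq_div_pow_of_deriv_eq_zero {Φ : ℝ → ℝ} (hΦ : ContDiffOn ℝ 1 Φ (Set.Ioi 0)) {a b : ℝ}
    (ha : 0 < a) (hab : a < b) (h0 : ∀ x ∈ Set.Ioo a b, 3 * Φ x + x * deriv Φ x = 0) :
    ∃ C, ∀ x ∈ Set.Ioo a b, Φ x = C / x ^ 3 := by
  have hd : ∀ x ∈ Set.Ioo a b, HasDerivAt (fun x => x ^ 3 * Φ x) 0 x := fun x hx => by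
    have hx0 : 0 < x := ha.trans hx.1
    have h1 : HasDerivAt Φ (deriv Φ x) x := ((hΦ.contDiffAt
      (isOpen_Ioi.mem_nhds hx0)).differentiableAt one_ne_zero).hasDerivAt
    refine ((hasDerivAt_pow 3 x).mul h1).congr_deriv ?_
    have := h0 x hx
    norm_num
    linear_combination x ^ 2 * this
  have hm : (a + b) / 2 ∈ Set.Ioo a b := ⟨by linarith, by linarith⟩
  refine ⟨((a + b) / 2) ^ 3 * Φ ((a + b) / 2), fun x hx => ?_⟩
  have h2 := isOpen_Ioo.is_const_of_deriv_eq_zero isPreconnected_Ioo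
    (fun y hy => (hd y hy).differentiableAt.differentiableWithinAt)
    (fun y hy => (hd y hy).deriv) hm hx
  have hx0 : x ^ 3 ≠ 0 := pow_ne_zero 3 (ha.trans hx.1).ne'
  rw [h2, mul_div_cancel_left₀ _ hx0]

/-- If `Y c` is not vertical at some `θ`, then by continuity neither is `Y` at `e^s c` for small
`s`, since dilations do not change the vertical space. Pointwise non-degeneracy must then fail at
every length near `ℓ_c`, which forces `Φ = C x⁻³` on an interval. -/
theorem mem_vertical_of_smoothField {Φ : ℝ → ℝ} (hΦ : ContDiffOn ℝ 1 Φ (Set.Ioi 0))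
    (hpos : ∀ x, 0 < x → 0 < Φ x)
    (hne : ∀ a b C : ℝ, 0 < a → a < b → ¬ ∀ x ∈ Set.Ioo a b, Φ x = C / x ^ 3)
    {Y : Imm → Loop} (hY : SmoothField Y) (h0 : ∀ c k, lengthForm Φ c (Y c) k = 0) (c : Imm) :
    Y c ∈ vertical c := by
  refine mem_vertical_of_cross3 fun θ => ?_
  by_contra hθ
  have hl := length_pos c
  set γ : (Fin 1 → ℝ) → Imm := fun p => scaleImm (Real.exp (p 0)) (Real.exp_pos _) c with hγdef
  have hγ : SmoothFamily fun p => (γ p).1 := (SmoothFamily.const c.1).smul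
    (Real.contDiff_exp.comp (contDiff_apply ℝ ℝ 0))
  have hγ0 : γ (fun _ => 0) = c := Subtype.ext (by simp [hγdef, scaleImm])
  have hcont : Continuous fun s : ℝ =>
      cross3 (deriv c.1.1 θ) ((Y (γ fun _ => s)).1 θ) :=
    continuous_cross3 continuous_const ((continuous_family (hY 1 γ hγ)).comp
      (by fun_prop : Continuous fun s : ℝ => ((fun _ => s : Fin 1 → ℝ), θ)))
  have hev := hcont.continuousAt.eventually_ne (x := 0) (by rwa [hγ0])
  obtain ⟨ε, hε, hball⟩ := Metric.eventually_nhds_iff.1 hev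
  have hzero : ∀ s, |s| < ε →
      3 * Φ (Real.exp s * length c) + Real.exp s * length c * deriv Φ (Real.exp s * length c)
        = 0 := by
    intro s hs
    by_contra hnz
    refine hball (by simpa using hs) ?_
    have hls : length (γ fun _ => s) = Real.exp s * length c := length_scaleImm _ c
    have hv := (lengthForm_nondeg_iff (hpos _ (length_pos (γ fun _ => s)))).2
      (by rw [hls]; exact hnz) _ (h0 (γ fun _ => s))
    rw [hγdef, vertical_scaleImm] at hv
    exact cross3_of_mem_vertical hv θ
  obtain ⟨C, hC⟩ := eq_div_pow_of_deriv_eq_zero hΦ (a := Real.exp (-ε) * length c)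
    (b := Real.exp ε * length c) (by positivity)
    (mul_lt_mul_of_pos_right (Real.exp_lt_exp.2 (by linarith)) hl) fun x hx => by
      have hx0 : 0 < x / length c :=
        div_pos (lt_trans (mul_pos (Real.exp_pos _) hl) hx.1) hl
      -- Each `x` in the interval is the length of the dilated curve with parameter `s = log (x /
      -- ℓ_c)`.
      have h1 := hzero (Real.log (x / length c)) (abs_lt.2
        ⟨(Real.lt_log_iff_exp_lt hx0).2 ((lt_div_iff₀ hl).2 hx.1),
          (Real.log_lt_iff_lt_exp hx0).2 ((div_lt_iff₀ hl).2 hx.2)⟩)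
      rwa [Real.exp_log hx0, div_mul_cancel₀ _ hl.ne'] at h1
  exact hne _ _ C (by positivity)
    (mul_lt_mul_of_pos_right (Real.exp_lt_exp.2 (by linarith)) hl) hC

/-! ### Two-forms on quotients -/

namespace QuotData

variable (D : QuotData) (Φ : ℝ → ℝ)

/-- The form on the tangent spaces of a quotient that `lengthForm Φ` induces. -/
def descendForm (hker : ∀ c, vertical c ⊔ D.fol c ≤ LinearMap.ker (lengthForm Φ c))
    (c : D.carrier) : D.Tang c →ₗ[ℝ] D.Tang c →ₗ[ℝ] ℝ :=
  ((vertical c.1 ⊔ D.fol c.1).comap (D.tangent c.1).subtype).liftQ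
    (((vertical c.1 ⊔ D.fol c.1).comap (D.tangent c.1).subtype).liftQ
      ((lengthForm Φ c.1).compl₁₂ (D.tangent c.1).subtype (D.tangent c.1).subtype)
      (fun v hv => by
        have h1 : lengthForm Φ c.1 v.1 = 0 := hker c.1 hv
        ext k
        simp [h1])).flip
    (fun v hv => by
      have h1 : lengthForm Φ c.1 v.1 = 0 := hker c.1 hv
      refine Submodule.linearMap_qext _ (LinearMap.ext fun k => ?_)
      change lengthForm Φ c.1 k.1 v.1 = 0
      -- Antisymmetry carries the vanishing from the first slot over to the second.
      rw [lengthForm_swap, h1, LinearMap.zero_apply, neg_zero]) |>.flip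

variable {Φ} (hΦ : ContDiffOn ℝ 1 Φ (Set.Ioi 0))
  (hker : ∀ c, vertical c ⊔ D.fol c ≤ LinearMap.ker (lengthForm Φ c))

theorem descendForm_proj (c : D.carrier) (h k : D.tangent c.1) :
    D.descendForm Φ hker c (D.proj c h) (D.proj c k) = lengthForm Φ c.1 h.1 k.1 := rfl

theorem proj_surjective (c : D.carrier) : Function.Surjective (D.proj c) :=
  Submodule.mkQ_surjective _

theorem proj_eq_zero_iff (c : D.carrier) (h : D.tangent c.1) :
    D.proj c h = 0 ↔ h.1 ∈ vertical c.1 ⊔ D.fol c.1 :=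
  Submodule.Quotient.mk_eq_zero _

/-- The two-form on a quotient that `lengthForm Φ` induces. -/
def descend : D.TwoForm where
  form := D.descendForm Φ hker
  alt c u := by
    obtain ⟨h, rfl⟩ := D.proj_surjective c u
    exact lengthForm_self Φ c.1 h.1
  reparam_inv c c' φ hc h k h' k' hh hk := by
    rw [descendForm_proj, descendForm_proj, hh, hk, hc, lengthForm_reparam]
  leaf_inv γ ξ η hγ hτ hξ hη := by
    choose τ hτF hτV using hτ
    have h0 : ∀ t x y, lengthForm Φ (γ (t, x, y)).1 (τ t x y) = 0 := fun t x y =>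
      hker _ (Submodule.mem_sup_right (hτF t x y))
    exact lengthForm_leaf_inv hΦ (γ := fun p => (γ p).1) (τ := fun p => τ p.1 p.2.1 p.2.2)
      (ξ := fun p => (ξ p).1) (η := fun p => (η p).1) hγ hτV hξ hη
      (fun t x y => by simp only [h0, LinearMap.zero_apply, and_self])
  cont n γ ξ η hγ hξ hη := continuous_lengthForm hΦ hγ hξ hη

theorem descend_closed : (D.descend hΦ hker).Closed := fun γ ξ η ζ hγ hξ hη hζ =>
  integral_lengthForm_cube hΦ (γ := fun p => (γ p).1) (ξ := fun p => (ξ p).1)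
    (η := fun p => (η p).1) (ζ := fun p => (ζ p).1) hγ hξ hη hζ

theorem descend_nondegAt_iff (c : D.carrier) : (D.descend hΦ hker).NondegAt c ↔
    ∀ h ∈ D.tangent c.1, (∀ k ∈ D.tangent c.1, lengthForm Φ c.1 h k = 0) →
      h ∈ vertical c.1 ⊔ D.fol c.1 := by
  constructor
  · intro H h hh h0
    refine (D.proj_eq_zero_iff c ⟨h, hh⟩).1 (H _ fun v => ?_)
    obtain ⟨k, rfl⟩ := D.proj_surjective c v
    exact h0 k.1 k.2
  · intro H u hu
    obtain ⟨h, rfl⟩ := D.proj_surjective c u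
    exact (D.proj_eq_zero_iff c h).2 (H h.1 h.2 fun k hk => hu (D.proj c ⟨k, hk⟩))

end QuotData

theorem vertical_le_ker (Φ : ℝ → ℝ) (c : Imm) :
    vertical c ≤ LinearMap.ker (lengthForm Φ c) := fun _ hv =>
  LinearMap.ext fun k => lengthForm_vertical Φ hv k

theorem shapeSpace_le_ker (Φ : ℝ → ℝ) (c : Imm) :
    vertical c ⊔ shapeSpace.fol c ≤ LinearMap.ker (lengthForm Φ c) :=
  sup_le (vertical_le_ker Φ c) bot_le

/-! ### The scale invariant case -/

section ScaleInvariant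

variable {Φ : ℝ → ℝ} {C : ℝ} (hC : ∀ x, 0 < x → Φ x = C / x ^ 3)

include hC in
theorem deriv_of_eq_div_pow {x : ℝ} (hx : 0 < x) : deriv Φ x = -(3 * C) / x ^ 4 := by
  have h1 : HasDerivAt (fun x : ℝ => C / x ^ 3) (-(3 * C) / x ^ 4) x := by
    refine ((hasDerivAt_const x C).div (hasDerivAt_pow 3 x) (pow_ne_zero 3 hx.ne')).congr_deriv ?_
    norm_num
    field_simp
  refine (h1.congr_of_eventuallyEq ?_).deriv
  filter_upwards [isOpen_Ioi.mem_nhds hx] with y hy using hC y hy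

include hC in
theorem degenerate_of_eq_div_pow {x : ℝ} (hx : 0 < x) : 3 * Φ x + x * deriv Φ x = 0 := by
  rw [deriv_of_eq_div_pow hC hx, hC x hx]
  field_simp
  ring

include hC in
theorem scaleBinormal_le_ker (c : Imm) : scaleBinormal c ≤ LinearMap.ker (lengthForm Φ c) := by
  have h0 := degenerate_of_eq_div_pow hC (length_pos c)
  refine Submodule.span_le.2 ?_
  rintro v (rfl | rfl) <;> refine LinearMap.ext fun k => ?_
  · rw [lengthForm_scale, h0, zero_mul, neg_zero, LinearMap.zero_apply]
  · rw [lengthForm_binormal, h0, zero_mul, LinearMap.zero_apply]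

theorem span_binormal_le (c : Imm) : Submodule.span ℝ {binormal c} ≤ scaleBinormal c :=
  Submodule.span_mono (by simp)

include hC in
theorem leafSpace_le_ker (c : Imm) :
    vertical c ⊔ leafSpace.fol c ≤ LinearMap.ker (lengthForm Φ c) :=
  sup_le (vertical_le_ker Φ c) (scaleBinormal_le_ker hC c)

include hC in
theorem unitLeafSpace_le_ker (c : Imm) :
    vertical c ⊔ unitLeafSpace.fol c ≤ LinearMap.ker (lengthForm Φ c) :=
  sup_le (vertical_le_ker Φ c) ((span_binormal_le c).trans (scaleBinormal_le_ker hC c))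

include hC in
theorem exists_of_lengthForm_eq_zero {c : Imm} (hpos : 0 < Φ (length c)) {h : Loop}
    (h0 : ∀ k, lengthForm Φ c h k = 0) :
    ∃ v ∈ vertical c, ∃ a b : ℝ, h = v + (a • c.1 + b • binormal c) := by
  obtain ⟨a, b, hab⟩ := mem_vertical_sup_of_lengthForm hpos
    (degenerate_of_eq_div_pow hC (length_pos c)) h0
  exact ⟨_, hab, a, b, (sub_add_cancel _ _).symm⟩

include hC in
theorem leafSpace_nondeg (hpos : ∀ x, 0 < x → 0 < Φ x) (hΦ : ContDiffOn ℝ 1 Φ (Set.Ioi 0))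
    (c : leafSpace.carrier) :
    (leafSpace.descend hΦ (leafSpace_le_ker hC)).NondegAt c := by
  rw [QuotData.descend_nondegAt_iff]
  intro h _ h0
  obtain ⟨v, hv, a, b, rfl⟩ := exists_of_lengthForm_eq_zero hC (hpos _ (length_pos c.1))
    fun k => h0 k trivial
  exact Submodule.add_mem_sup hv (Submodule.mem_span_pair.2 ⟨a, b, rfl⟩)

include hC in
theorem unitLeafSpace_nondeg (hpos : ∀ x, 0 < x → 0 < Φ x)
    (hΦ : ContDiffOn ℝ 1 Φ (Set.Ioi 0)) (c : unitLeafSpace.carrier) :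
    (unitLeafSpace.descend hΦ (unitLeafSpace_le_ker hC)).NondegAt c := by
  rw [QuotData.descend_nondegAt_iff]
  intro h hh h0
  have hh : dLength c.1 h = 0 := hh
  have hl := (length_pos c.1).ne'
  obtain ⟨v, hv, a, b, rfl⟩ := exists_of_lengthForm_eq_zero hC (hpos _ (length_pos c.1))
    (h := h) fun k => by
      have h1 : lengthForm Φ c.1 c.1.1 = 0 :=
        scaleBinormal_le_ker hC c.1 (Submodule.subset_span (by simp))
      -- An arbitrary `k` is projected to `ker dℓ` along the scaling field. That field lies in the
      -- kernel of the form, so the pairing with `h` is unchanged and `h` pairs to zero with all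
      -- loops.
      have h2 := h0 (k - (dLength c.1 k / length c.1) • c.1.1)
        (show dLength c.1 _ = 0 by
          rw [map_sub, map_smul, dLength_self, smul_eq_mul, div_mul_cancel₀ _ hl, sub_self])
      rw [map_sub, map_smul, lengthForm_swap Φ c.1 c.1.1, h1, LinearMap.zero_apply, neg_zero,
        smul_zero, sub_zero] at h2
      exact h2
  -- Tangency to `{ℓ = 1}` forces the coefficient `a` of the scaling field to vanish.
  simp only [map_add, map_smul, dLength_vertical hv, dLength_self, dLength_binormal, smul_eq_mul,
    mul_zero, zero_add, add_zero, mul_eq_zero, hl, or_false] at hh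
  rw [hh, zero_smul, zero_add]
  exact Submodule.add_mem_sup hv (Submodule.mem_span_singleton.2 ⟨b, rfl⟩)

include hC in
-- On `ker dℓ` the `dℓ ∧ Θ` term drops out. The restriction of `3C Ω^MW` is thus also a restriction
-- of `lengthForm Φ`, whose closedness and invariance apply.
theorem lengthForm_unit {c : Imm} (hc : length c = 1) {h k : Loop} (hh : dLength c h = 0)
    (hk : dLength c k = 0) : lengthForm Φ c h k = 3 * C * OmegaMW c h k := by
  rw [lengthForm_apply, hh, hk, hc, hC 1 one_pos]
  ring

include hC in
-- Expanding `3C ℓ⁻¹ Ω^MW` on the vectors `h/ℓ - (dℓ(h)/ℓ²) c`, the leading term has coefficient `3C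
-- ℓ⁻³ = 3Φ`. The cross terms, evaluated by `ι_I Ω^MW = -Θ`, give `dℓ ∧ Θ` with coefficient `3C ℓ⁻⁴
-- = -Φ'`.
theorem lengthForm_normalize (c : Imm) (h k : Loop) :
    lengthForm Φ (normalize c) (dNormalize c h).1 (dNormalize c k).1 = lengthForm Φ c h k := by
  have hl := (length_pos c).ne'
  rw [lengthForm_unit hC (length_normalize c) (dNormalize c h).2 (dNormalize c k).2,
    lengthForm_apply, hC _ (length_pos c), deriv_of_eq_div_pow hC (length_pos c),
    OmegaMW_normalize, dNormalize, dNormalize, ← marsdenWeinstein_apply c (_ - _)]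
  simp only [map_sub, map_smul, LinearMap.sub_apply, LinearMap.smul_apply, smul_eq_mul,
    marsdenWeinstein_apply, OmegaMW_scale, liouville_scale]
  rw [OmegaMW_swap c c.1 h, OmegaMW_scale]
  field_simp
  ring

end ScaleInvariant

/-! ### The identification of the two quotients -/

theorem dNormalize_val (c : Imm) (h : Loop) :
    (dNormalize c h).1 = (length c)⁻¹ • h - (dLength c h / length c ^ 2) • c.1 := rfl

/-- Normalisation collapses the scaling direction and keeps the binormal one, so it maps leaves to
leaves. One factor `ℓ⁻¹` comes from the differential, the other from the weight of the binormal
field. -/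
theorem dNormalize_scaleBinormal (c : Imm) (a b : ℝ) :
    (dNormalize c (a • c.1 + b • binormal c)).1 = (b / length c ^ 2) • binormal (normalize c) := by
  have hl := (length_pos c).ne'
  rw [dNormalize_val, binormal_normalize]
  simp only [map_add, map_smul, dLength_self, dLength_binormal, smul_eq_mul, mul_zero, add_zero,
    smul_add, smul_smul]
  rw [show a * length c / length c ^ 2 = (length c)⁻¹ * a by field_simp,
    show b / length c ^ 2 * length c = (length c)⁻¹ * b by field_simp]
  abel

theorem toSpace_inUnit_eq {c₀ c₁ : leafSpace.carrier} (h : leafSpace.Rel c₀ c₁) :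
    unitLeafSpace.toSpace (inUnit c₀.1) = unitLeafSpace.toSpace (inUnit c₁.1) := by
  refine Quot.sound ?_
  rcases h with ⟨φ, hφ⟩ | ⟨γ, hγ, hv, rfl, rfl⟩
  · refine Or.inl ⟨φ, ?_⟩
    change normalize c₁.1 = (normalize c₀.1).reparam φ
    rw [hφ, normalize_reparam]
  · refine Or.inr ⟨fun t => inUnit (γ t).1, smoothFamily_normalize hγ, fun t => ?_, rfl, rfl⟩
    obtain ⟨v, hvF, hvV⟩ := hv t
    obtain ⟨a, b, rfl⟩ := Submodule.mem_span_pair.1 hvF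
    refine ⟨_, ?_, hasVelocity_normalize (γ := fun t => (γ t).1) hγ hvV⟩
    rw [dNormalize_scaleBinormal]
    exact Submodule.mem_span_singleton.2 ⟨_, rfl⟩

theorem toSpace_inLeaf_eq {c₀ c₁ : unitLeafSpace.carrier} (h : unitLeafSpace.Rel c₀ c₁) :
    leafSpace.toSpace (inLeaf c₀.1) = leafSpace.toSpace (inLeaf c₁.1) := by
  refine Quot.sound ?_
  rcases h with ⟨φ, hφ⟩ | ⟨γ, hγ, hv, rfl, rfl⟩
  · exact Or.inl ⟨φ, hφ⟩
  · refine Or.inr ⟨fun t => inLeaf (γ t).1, hγ, fun t => ?_, rfl, rfl⟩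
    obtain ⟨v, hvF, hvV⟩ := hv t
    exact ⟨v, span_binormal_le _ hvF, hvV⟩

/-- The path `t ↦ ℓ_c^{-t} c` has velocity `-log ℓ_c` times the scaling field, so it stays in a leaf
and reaches `c / ℓ_c` at time `1`. -/
theorem leafSpace_rel_normalize (c : Imm) : leafSpace.Rel (inLeaf c) (inLeaf (normalize c)) := by
  refine Or.inr ⟨fun t => inLeaf (scaleImm (Real.exp (t * -Real.log (length c)))
    (Real.exp_pos _) c), (SmoothFamily.const c.1).smul (f := fun t : ℝ =>
      Real.exp (t * -Real.log (length c))) (by fun_prop), fun t => ⟨-Real.log (length c) •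
      (scaleImm (Real.exp (t * -Real.log (length c))) (Real.exp_pos _) c).1,
      Submodule.smul_mem _ _ (Submodule.subset_span (by simp [inLeaf])), fun θ => ?_⟩, ?_, ?_⟩
  · have h1 : HasDerivAt (fun s : ℝ => Real.exp (s * -Real.log (length c)))
        (Real.exp (t * -Real.log (length c)) * -Real.log (length c)) t := by
      simpa using ((hasDerivAt_id t).mul_const (-Real.log (length c))).exp
    refine (h1.smul_const (c.1.1 θ)).congr_deriv ?_
    rw [mul_comm, mul_smul]
    rfl
  · exact Subtype.ext (Subtype.ext (by simp [inLeaf, scaleImm]))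
  · refine Subtype.ext (Subtype.ext ?_)
    change Real.exp (1 * -Real.log (length c)) • c.1 = (length c)⁻¹ • c.1
    rw [one_mul, Real.exp_neg, Real.exp_log (length_pos c)]

/-- The bijection of the quotients induced by `c ↦ c / ℓ_c`. -/
def leafEquiv : leafSpace.Space ≃ unitLeafSpace.Space where
  toFun := Quot.lift (fun c => unitLeafSpace.toSpace (inUnit c.1)) fun _ _ h => toSpace_inUnit_eq h
  invFun := Quot.lift (fun c => leafSpace.toSpace (inLeaf c.1)) fun _ _ h => toSpace_inLeaf_eq h
  left_inv := Quot.ind fun c => (Quot.sound (leafSpace_rel_normalize c.1)).symm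
  right_inv := Quot.ind fun c => congrArg unitLeafSpace.toSpace
    (Subtype.ext (normalize_of_length_eq_one c.2))

/-- The differential of `c ↦ c / ℓ_c` as a linear map. -/
def dNormalizeLin (c : Imm) :
    leafSpace.tangent (inLeaf c).1 →ₗ[ℝ] unitLeafSpace.tangent (inUnit c).1 where
  toFun h := dNormalize c h.1
  map_add' h k := by
    refine Subtype.ext ?_
    change (dNormalize c (h.1 + k.1)).1 = (dNormalize c h.1).1 + (dNormalize c k.1).1
    simp only [dNormalize_val, map_add, add_div, add_smul, smul_add]
    abel
  map_smul' r h := by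
    refine Subtype.ext ?_
    change (dNormalize c (r • h.1)).1 = r • (dNormalize c h.1).1
    simp only [dNormalize_val, map_smul, smul_sub, smul_smul, smul_eq_mul, mul_div_assoc,
      mul_comm r (length c)⁻¹]

/-- Multiplication with the length, the right inverse of `dNormalizeLin`. -/
def lengthSmul (c : Imm) :
    unitLeafSpace.tangent (inUnit c).1 →ₗ[ℝ] leafSpace.tangent (inLeaf c).1 where
  toFun h := ⟨length c • h.1, trivial⟩
  map_add' h k := Subtype.ext (smul_add _ h.1 k.1)
  map_smul' r h := Subtype.ext (smul_comm _ r h.1)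

/-- The differential of `c ↦ c / ℓ_c` on the tangent spaces of the quotients. -/
def tangEquiv (c : Imm) : leafSpace.Tang (inLeaf c) ≃ₗ[ℝ] unitLeafSpace.Tang (inUnit c) :=
  LinearEquiv.ofLinearMap
    (Submodule.mapQ _ _ (dNormalizeLin c) (by
      intro h hh
      change h.1 ∈ vertical c ⊔ scaleBinormal c at hh
      change (dNormalize c h.1).1 ∈ vertical (normalize c) ⊔ Submodule.span ℝ {binormal (normalize c)}
      obtain ⟨v, hv, w, hw, e⟩ := Submodule.mem_sup.1 hh
      obtain ⟨a, b, rfl⟩ := Submodule.mem_span_pair.1 hw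
      have e1 : (dNormalize c h.1).1 = (length c)⁻¹ • v +
          (b / length c ^ 2) • binormal (normalize c) := by
        rw [← dNormalize_scaleBinormal c a b, ← e]
        simp only [dNormalize_val, map_add, dLength_vertical hv, zero_add, smul_add]
        abel
      rw [e1]
      refine Submodule.add_mem_sup ?_ (Submodule.mem_span_singleton.2 ⟨_, rfl⟩)
      rw [vertical_normalize]
      exact Submodule.smul_mem _ _ hv))
    (Submodule.mapQ _ _ (lengthSmul c) (by
      intro h hh
      change h.1 ∈ vertical (normalize c) ⊔ Submodule.span ℝ {binormal (normalize c)} at hh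
      change length c • h.1 ∈ vertical c ⊔ scaleBinormal c
      rw [vertical_normalize, binormal_normalize] at hh
      have hs : Submodule.span ℝ {length c • binormal c} ≤ scaleBinormal c :=
        Submodule.span_le.2 (Set.singleton_subset_iff.2
          (Submodule.smul_mem _ _ (Submodule.subset_span (by simp))))
      exact Submodule.smul_mem _ _ (sup_le_sup_left hs (vertical c) hh)))
    (by
      refine Submodule.linearMap_qext _ (LinearMap.ext fun h => ?_)
      refine congrArg (Submodule.mkQ _) (Subtype.ext ?_)
      change (length c)⁻¹ • (length c • h.1) - (dLength c (length c • h.1) / length c ^ 2) • c.1 = h.1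
      have h1 : dLength c h.1 = 0 := (dLength_normalize c h.1).symm.trans h.2
      rw [map_smul, h1, smul_zero, zero_div, zero_smul, sub_zero, smul_smul,
        inv_mul_cancel₀ (length_pos c).ne', one_smul])
    (by
      refine Submodule.linearMap_qext _ (LinearMap.ext fun h => ?_)
      -- This composite is the identity only modulo the scaling field, unlike the previous one,
      -- which is the identity already before passing to the quotient.
      refine (Submodule.Quotient.eq _).2 ?_
      change length c • ((length c)⁻¹ • h.1 - (dLength c h.1 / length c ^ 2) • c.1) - h.1
        ∈ vertical c ⊔ scaleBinormal c
      rw [smul_sub, smul_smul, mul_inv_cancel₀ (length_pos c).ne', one_smul, sub_sub_cancel_left]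
      exact neg_mem (Submodule.smul_mem _ _ (Submodule.smul_mem _ _
        (Submodule.mem_sup_right (Submodule.subset_span (by simp))))))

/-! ### Horizontal Hamiltonian vectors -/

/-- Two Hamiltonian vectors differ by an element of the kernel, which is vertical; if both are
horizontal, the difference is orthogonal to itself and vanishes. The factor `r` covers `Ω^MW` and
`Ω^id = 3 Ω^MW` at once. -/
theorem isHGrad_OmegaMW_iff {r : ℝ} (hr : r ≠ 0) (c : Imm) (X : Loop) :
    IsHGrad (fun c h k => r * OmegaMW c h k) length c X ↔ X = r⁻¹ • binormal c := by
  constructor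
  · rintro ⟨h1, h2⟩
    have h3 : X - r⁻¹ • binormal c ∈ vertical c := by
      refine mem_vertical_of_OmegaMW fun k => ?_
      rw [← marsdenWeinstein_apply, map_sub, map_smul, LinearMap.sub_apply, LinearMap.smul_apply,
        marsdenWeinstein_apply, marsdenWeinstein_apply, OmegaMW_binormal,
        ← (h1 k).unique (hasDirDeriv_length c k), smul_eq_mul, inv_mul_cancel_left₀ hr, sub_self]
    have h4 := h2 _ h3
    have h5 : pairing c (X - r⁻¹ • binormal c) (X - r⁻¹ • binormal c) = 0 := by
      conv_lhs => rw [sub_eq_add_neg, ← neg_smul, pairing_add_left, pairing_smul_left]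
      rw [neg_smul, ← sub_eq_add_neg, h4, pairing_binormal_vertical h3, mul_zero, add_zero]
    exact sub_eq_zero.1 (eq_zero_of_pairing_self h5)
  · rintro rfl
    refine ⟨fun k => ?_, fun v hv => ?_⟩
    · have h1 := hasDirDeriv_length c k
      rw [← OmegaMW_binormal] at h1
      change HasDirDeriv length c k (r * marsdenWeinstein c (r⁻¹ • binormal c) k)
      rwa [map_smul, LinearMap.smul_apply, smul_eq_mul, mul_inv_cancel_left₀ hr]
    · rw [pairing_smul_left, pairing_binormal_vertical hv, mul_zero]

end SpaceCurves

end

/-! ### The main theorem. -/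

open SpaceCurves in
theorem corollary4p1 (Φ : ℝ → ℝ) (hΦ : ContDiffOn ℝ 1 Φ (Set.Ioi 0)) (hpos : ∀ x, 0 < x → 0 < Φ x) :
    -- all derivatives that define the forms exist, and `dLength` is the variation of length
    (∀ c h k, (∃ a, HasDirDeriv (fun b => liouville (lengthOp Φ) b k) c h a) ∧
      (∃ a, HasDirDeriv (fun b => liouville idOp b k) c h a) ∧
      HasDirDeriv length c h (pairing c (Ds c h) (Ds c c.1))) ∧
    -- the two formulas
    (∀ c h k, Omega (lengthOp Φ) c h k = Φ (length c) * Omega idOp c h k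
      - deriv Φ (length c) * (pairing c (Ds c h) (Ds c c.1) * liouville idOp c k
        - pairing c (Ds c k) (Ds c c.1) * liouville idOp c h)) ∧
    (∀ c h k, Omega (lengthOp Φ) c h k = Φ (length c) * Omega idOp c h k
      + deriv Φ (length c) * (pairing c h (Ds c (Ds c c.1)) * liouville idOp c k
        - pairing c k (Ds c (Ds c c.1)) * liouville idOp c h)) ∧
    -- the form on the shape space
    (∃ ρ : shapeSpace.TwoForm,
      (∀ c h k, ρ.form (inShape c) (tangShape c h) (tangShape c k) = Omega (lengthOp Φ) c h k) ∧
      ρ.Closed ∧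
      (∀ c, ρ.NondegAt (inShape c) ↔
        3 * Φ (length c) + length c * deriv Φ (length c) ≠ 0) ∧
      ((∀ x, 0 < x → 3 * Φ x + x * deriv Φ x ≠ 0) → ρ.IsSymplectic)) ∧
    -- non-degeneracy on vector fields when `Φ` is on no interval a multiple of `ℓ⁻³`
    ((∀ a b C : ℝ, 0 < a → a < b → ¬ ∀ x ∈ Set.Ioo a b, Φ x = C / x ^ 3) →
      ∀ Y : Imm → Loop, SmoothField Y → (∀ c k, Omega (lengthOp Φ) c (Y c) k = 0) →
        ∀ c, Y c ∈ vertical c) ∧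
    -- the field `D_s c × D_s² c` and the rank two involutive bundle that it spans with `I`
    (∀ c X, (IsHGrad OmegaMW length c X ↔ X = binormal c) ∧
      (IsHGrad (Omega idOp) length c X ↔ X = (1 / 3 : ℝ) • binormal c)) ∧
    (∀ c, LinearIndependent ℝ
      ![(vertical c).mkQ c.1, (vertical c).mkQ (binormal c)]) ∧
    (∀ c, ∃ A B, HasFieldDeriv binormal c c.1 A ∧
      HasFieldDeriv (fun b => b.1) c (binormal c) B ∧ A - B ∈ scaleBinormal c) ∧
    -- the scale invariant case
    (∀ C : ℝ, (∀ x, 0 < x → Φ x = C / x ^ 3) →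
      ∃ (ρ : leafSpace.TwoForm) (σ : unitLeafSpace.TwoForm)
        (e : leafSpace.Space ≃ unitLeafSpace.Space),
        (∀ c h k, ρ.form (inLeaf c) (tangLeaf c h) (tangLeaf c k)
          = Omega (lengthOp Φ) c h k) ∧
        ρ.IsSymplectic ∧
        (∀ (c : unitLeafSpace.carrier) (h k : unitLeafSpace.tangent c.1),
          σ.form c (unitLeafSpace.proj c h) (unitLeafSpace.proj c k)
            = 3 * C * OmegaMW c.1 h.1 k.1) ∧
        σ.IsSymplectic ∧
        -- the two quotients are identified through `c ↦ c / ℓ_c` and the inclusion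
        (∀ (n : ℕ) (γ : (Fin n → ℝ) → Imm), SmoothFamily (fun p => (γ p).1) →
          SmoothFamily fun p => (normalize (γ p)).1) ∧
        (∀ c h, HasFieldDeriv (fun b => (normalize b).1) c h (dNormalize c h).1) ∧
        (∀ c, e (leafSpace.toSpace (inLeaf c)) = unitLeafSpace.toSpace (inUnit c)) ∧
        (∀ c : unitLeafSpace.carrier,
          e.symm (unitLeafSpace.toSpace c) = leafSpace.toSpace (inLeaf c.1)) ∧
        ∀ c, ∃ T : leafSpace.Tang (inLeaf c) ≃ₗ[ℝ] unitLeafSpace.Tang (inUnit c),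
          (∀ h, T (tangLeaf c h) = unitLeafSpace.proj (inUnit c) (dNormalize c h)) ∧
          ∀ u v, ρ.form (inLeaf c) u v = σ.form (inUnit c) (T u) (T v)) := by
  refine ⟨fun c h k => ⟨⟨_, hasDirDeriv_liouville_lengthOp hΦ c h k⟩,
    ⟨_, hasDirDeriv_liouville c h k⟩, hasDirDeriv_length c h⟩, fun c h k => ?_, fun c h k => ?_,
    ⟨shapeSpace.descend hΦ (shapeSpace_le_ker Φ), fun c h k => (Omega_lengthOp hΦ c h k).symm,
      shapeSpace.descend_closed hΦ _, ?_⟩, fun hne Y hY h0 => ?_, fun c X => ⟨?_, ?_⟩,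
    fun c => ?_, fun c => ?_, fun C hC => ?_⟩
  · rw [Omega_lengthOp hΦ, Omega_idOp, lengthForm_apply, dLength_apply, dLength_apply]
    ring
  · rw [Omega_lengthOp hΦ, Omega_idOp, lengthForm_apply, dLength_eq_neg_pairing,
      dLength_eq_neg_pairing]
    ring
  · have hnd : ∀ c, (shapeSpace.descend hΦ (shapeSpace_le_ker Φ)).NondegAt (inShape c) ↔
        3 * Φ (length c) + length c * deriv Φ (length c) ≠ 0 := fun c => by
      rw [QuotData.descend_nondegAt_iff, ← lengthForm_nondeg_iff (hpos _ (length_pos c))]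
      have hs : vertical c ⊔ shapeSpace.fol c = vertical c := sup_bot_eq _
      exact ⟨fun H h h0 => hs ▸ H h trivial fun k _ => h0 k,
        fun H h _ h0 => hs.symm ▸ H h fun k => h0 k trivial⟩
    exact ⟨hnd, fun H => ⟨shapeSpace.descend_closed hΦ _, fun c =>
      (hnd c.1).2 (H _ (length_pos c.1))⟩⟩
  · exact mem_vertical_of_smoothField hΦ hpos hne hY fun c k =>
      (Omega_lengthOp hΦ c (Y c) k).symm.trans (h0 c k)
  · have := isHGrad_OmegaMW_iff one_ne_zero c X
    simpa only [one_mul, inv_one, one_smul] using this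
  · have := isHGrad_OmegaMW_iff three_ne_zero c X
    rw [show Omega idOp = fun c h k => 3 * OmegaMW c h k from
      funext fun c => funext fun h => funext fun k => Omega_idOp c h k, this, one_div]
  · refine LinearIndependent.pair_iff.2 fun a b hab => ?_
    rw [← map_smul, ← map_smul, ← map_add] at hab
    exact scale_binormal_independent ((Submodule.Quotient.mk_eq_zero _).1 hab)
  · refine ⟨_, _, hasFieldDeriv_binormal c, fun γ _ _ h => h, ?_⟩
    have hb : binormal c ∈ scaleBinormal c := Submodule.subset_span (by simp)
    exact sub_mem (neg_mem hb) hb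
  · refine ⟨leafSpace.descend hΦ (leafSpace_le_ker hC),
      unitLeafSpace.descend hΦ (unitLeafSpace_le_ker hC), leafEquiv,
      fun c h k => (Omega_lengthOp hΦ c h k).symm,
      ⟨leafSpace.descend_closed hΦ _, leafSpace_nondeg hC hpos hΦ⟩,
      fun c h k => lengthForm_unit hC c.2 h.2 k.2,
      ⟨unitLeafSpace.descend_closed hΦ _, unitLeafSpace_nondeg hC hpos hΦ⟩,
      fun n γ hγ => smoothFamily_normalize hγ, ?_, fun c => rfl, fun c => rfl,
      fun c => ⟨tangEquiv c, fun h => rfl, fun u v => ?_⟩⟩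
    · rintro c h γ hγ rfl hh
      exact hasVelocity_normalize hγ hh
    · obtain ⟨h, rfl⟩ := leafSpace.proj_surjective _ u
      obtain ⟨k, rfl⟩ := leafSpace.proj_surjective _ v
      exact (lengthForm_normalize hC c h.1 k.1).symm
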